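/- Let $\Bbbk$ be a field of characteristic zero and let $\mathfrak g$ be a ($\mathbb Z$-graded, uncurved) $L_\infty$ algebra over $\Bbbk$: a graded vector space with multilinear operations $\ell^s(v_1,\dots,v_s)=\{v_1,\dots,v_s\}$, $s\ge 1$, of degree $2-s$, graded symmetric with respect to the reduced degrees $|v|+1$, and satisfying the $L_\infty$ relations. Let $H^*(\mathfrak g)$ be its cohomology with respect to $\ell^1$. For a complete Noetherian local $\Bbbk$-algebra $(R,\mathfrak m)$, let $MC_{\mathfrak g}(R)$ be the set of $\alpha\in\mathfrak g^1\hat\otimes\mathfrak m$ (the $\mathfrak m$-adic completion of $\mathfrak g^1\otimes\mathfrak m$) with $\sum_{s\ge1}\frac1{s!}\{\alpha,\dots,\alpha\}=0$. Two elements of $MC_{\mathfrak g}(R)$ are gauge equivalent, written $\sim$, if they are connected by a finite series of flowlines of vector fields $v(\gamma,t)_\alpha=\sum_{i\ge0}\frac1{i!}\{\gamma(t),\alpha,\dots,\alpha\}$ ($i$ copies of $\alpha$), where $\gamma(t)$ lies in the $\mathfrak m$-adic completion of $\mathfrak g^0\otimes\mathfrak m[t]$. An element $\alpha\in MC_{\mathfrak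 g}(S)$ is *complete* if for every complete Noetherian local $\Bbbk$-algebra $R$ and every $\eta\in MC_{\mathfrak g}(R)$ there is a local $\Bbbk$-algebra homomorphism $\psi^*:S\to R$ with $\eta\sim\psi^*\alpha$; it is *versal* if moreover, for every such $\eta$, the map $\mathfrak m_S/\mathfrak m_S^2\to\mathfrak m_R/\mathfrak m_R^2$ induced by such a $\psi^*$ is uniquely determined. The projection of $\alpha\in MC_{\mathfrak g}(R)$ to $\mathfrak g^1\otimes\mathfrak m/\mathfrak m^2$ is $\ell^1$-closed, and contraction with its class in $H^1(\mathfrak g)\otimes\mathfrak m/\mathfrak m^2$ is the Kodaira--Spencer map $KS_\alpha:(\mathfrak m/\mathfrak m^2)^*\to H^1(\mathfrak g)$. **Theorem.** Let $R=\Bbbk[[r_1,\dots,r_k]]$ be a formal power series algebra, $k\ge 0$, and let $\beta\in MC_{\mathfrak g}(R)$. If $KS_\beta$ is an isomorphism, then $\beta$ is versal. If $KS_\beta$ is surjective, then $\beta$ is complete. -/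

import Mathlib

open scoped TensorProduct

universe w

/-- An `L∞` algebra structure on a `K`-vector space `V`, which is graded by `ℤ`:
`V = ⨁ i, 𝔤ⁱ` with `𝔤ⁱ = grading i`, and multilinear operations
`{v₁, …, vₛ} = bracket s v` for `s ≥ 1` (the value at `s = 0` is normalised to be zero,
i.e. there is no curvature), subject to the usual axioms. -/
structure LInfinityAlgebra (K : Type*) [Field K] (V : Type*) [AddCommGroup V] [Module K V] where
  /-- the homogeneous pieces -/
  grading : ℤ → Submodule K V
  /-- `V` is the direct sum of its homogeneous pieces -/
  isInternal : DirectSum.IsInternal grading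
  /-- the operations `ℓˢ` -/
  bracket : (s : ℕ) → MultilinearMap K (fun _ : Fin s => V) V
  /-- no curvature -/
  bracket_zero : bracket 0 = 0
  /-- `ℓˢ` has degree `2 - s` -/
  bracket_mem : ∀ (s : ℕ) (d : Fin s → ℤ) (v : Fin s → V), (∀ i, v i ∈ grading (d i)) →
    bracket s v ∈ grading (∑ i, d i + 2 - s)
  /-- Graded symmetry with respect to reduced degrees: swapping two adjacent homogeneous inputs
  `v`, `w` changes the sign by `(-1) ^ ((|v| + 1) (|w| + 1))`. -/
  bracket_swap : ∀ (s : ℕ) (d : Fin s → ℤ) (v : Fin s → V), (∀ i, v i ∈ grading (d i)) →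
    ∀ i j : Fin s, (j : ℕ) = i + 1 →
      bracket s (v ∘ Equiv.swap i j) = Int.negOnePow ((d i + 1) * (d j + 1)) • bracket s v
  /-- The `L∞` relations: the sum over `1 ≤ j ≤ s` and over all unshuffles `σ` (permutations that
  are increasing on the first `j` places and on the last `s - j` places) of
  `± {{v_σ(1), …, v_σ(j)}, v_σ(j+1), …, v_σ(s)}` vanishes.  The Koszul sign is the product of
  `(-1) ^ ((|v_σ(a)| + 1) (|v_σ(b)| + 1))` over all inversions `a < b`, `σ(b) < σ(a)`.
  (The terms with `j = 0` are zero.) -/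
  relation : ∀ (s : ℕ) (d : Fin s → ℤ) (v : Fin s → V), (∀ i, v i ∈ grading (d i)) →
    ∑ j : Fin (s + 1),
      ∑ σ : {σ : Equiv.Perm (Fin s) //
          (∀ a b : Fin s, a < b → (b : ℕ) < j → σ a < σ b) ∧
          (∀ a b : Fin s, a < b → (j : ℕ) ≤ a → σ a < σ b)},
        (∏ p : {p : Fin s × Fin s // p.1 < p.2 ∧ σ.1 p.2 < σ.1 p.1},
            Int.negOnePow ((d (σ.1 p.1.1) + 1) * (d (σ.1 p.1.2) + 1))) •
          bracket (s - j + 1)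
            (Fin.cons
              (bracket j fun i : Fin j => v (σ.1 ⟨i, by omega⟩))
              (fun i : Fin (s - j) => v (σ.1 ⟨j + i, by omega⟩))) = 0

noncomputable section

section BaseChange

variable {K : Type*} [Field K] {V W : Type*} [AddCommGroup V] [Module K V]
  [AddCommGroup W] [Module K W]

instance multilinearBaseChange_isScalarTower (A : Type*) [CommRing A] [Algebra K A] (s : ℕ) :
    IsScalarTower K A (MultilinearMap A (fun _ : Fin s => A ⊗[K] V) (A ⊗[K] W)) :=
  ⟨fun c a f => by ext v; simp⟩

/-- The `A`-multilinear extension of a `K`-multilinear map to `A ⊗ V`, characterised by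
`(a₁ ⊗ v₁, …, aₛ ⊗ vₛ) ↦ (a₁ ⋯ aₛ) ⊗ f (v₁, …, vₛ)`. -/
def multilinearBaseChange (A : Type*) [CommRing A] [Algebra K A] :
    (s : ℕ) → MultilinearMap K (fun _ : Fin s => V) W →ₗ[K]
      MultilinearMap A (fun _ : Fin s => A ⊗[K] V) (A ⊗[K] W)
  | 0 =>
    { toFun := fun f => MultilinearMap.constOfIsEmpty A _ (1 ⊗ₜ[K] f Fin.elim0)
      map_add' := fun f g => by ext; simp [TensorProduct.tmul_add]
      map_smul' := fun c f => by ext; simp [TensorProduct.tmul_smul] }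
  | s + 1 =>
    { toFun := fun f =>
        (((multilinearBaseChange A s) ∘ₗ f.curryLeft).liftBaseChange A).uncurryLeft
      map_add' := fun f g => by
        have h : (multilinearBaseChange A s) ∘ₗ (f + g).curryLeft =
            (multilinearBaseChange A s) ∘ₗ f.curryLeft +
              (multilinearBaseChange A s) ∘ₗ g.curryLeft := by
          rw [← LinearMap.comp_add]; rfl
        rw [h, LinearMap.liftBaseChange, map_add]
        rfl
      map_smul' := fun c f => by
        have h : (multilinearBaseChange A s) ∘ₗ (c • f).curryLeft =
            c • ((multilinearBaseChange A s) ∘ₗ f.curryLeft) := by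
          rw [← LinearMap.comp_smul]; rfl
        have h' : ∀ l : V →ₗ[K] MultilinearMap A (fun _ : Fin s => A ⊗[K] V) (A ⊗[K] W),
            (c • l).liftBaseChange A = c • l.liftBaseChange A := fun l => by
          ext v; simp
        rw [h, h']
        rfl }

theorem multilinearBaseChange_tmul (A : Type*) [CommRing A] [Algebra K A] (s : ℕ)
    (f : MultilinearMap K (fun _ : Fin s => V) W) (a : Fin s → A) (v : Fin s → V) :
    multilinearBaseChange A s f (fun i => a i ⊗ₜ[K] v i) = (∏ i, a i) ⊗ₜ[K] f v := by
  induction s with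
  | zero =>
    simp only [multilinearBaseChange, LinearMap.coe_mk, AddHom.coe_mk,
      MultilinearMap.constOfIsEmpty_apply, Finset.univ_eq_empty, Finset.prod_empty]
    rw [Subsingleton.elim v Fin.elim0]
    rfl
  | succ s ih =>
    simp only [multilinearBaseChange, LinearMap.coe_mk, AddHom.coe_mk,
      LinearMap.uncurryLeft_apply, LinearMap.liftBaseChange_tmul, LinearMap.comp_apply,
      smul_apply]
    have := ih (f.curryLeft (v 0)) (Fin.tail a) (Fin.tail v)
    change a 0 • (multilinearBaseChange A s (f.curryLeft (v 0))
      fun i => Fin.tail a i ⊗ₜ[K] Fin.tail v i) = _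
    rw [this, TensorProduct.smul_tmul', smul_eq_mul, Fin.prod_univ_succ,
      MultilinearMap.curryLeft_apply]
    congr 2
    exact Fin.cons_self_tail v

end BaseChange

section CompletedTensor

variable {K : Type*} [Field K]

/-- For an ideal `I` of a commutative `K`-algebra `A` and a `K`-vector space `M`, this is
`M ⊗̂ I`, the `I`-adic completion of the `A`-module `I ⊗ M`. -/
abbrev CompletedTensor (K : Type*) [Field K] {A : Type*} [CommRing A] [Algebra K A] (I : Ideal A)
    (M : Type*) [AddCommGroup M] [Module K M] : Type _ :=
  AdicCompletion I (I ⊗[K] M)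

variable {A B : Type*} [CommRing A] [Algebra K A] [CommRing B] [Algebra K B]

/-- An additive map which respects the adic filtrations induces maps on the quotients. -/
def adicQuotientMap {I : Ideal A} {J : Ideal B} {M N : Type*} [AddCommGroup M] [Module A M]
    [AddCommGroup N] [Module B N] (φ : M →+ N)
    (hφ : ∀ (n : ℕ) (x : M), x ∈ (I ^ n • ⊤ : Submodule A M) →
      φ x ∈ (J ^ n • ⊤ : Submodule B N)) (n : ℕ) :
    M ⧸ (I ^ n • ⊤ : Submodule A M) →+ N ⧸ (J ^ n • ⊤ : Submodule B N) :=
  QuotientAddGroup.map (I ^ n • ⊤ : Submodule A M).toAddSubgroup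
    (J ^ n • ⊤ : Submodule B N).toAddSubgroup φ (fun x hx => hφ n x hx)

/-- An additive map which respects the adic filtrations induces a map on completions. -/
def adicCompletionMap {I : Ideal A} {J : Ideal B} {M N : Type*} [AddCommGroup M] [Module A M]
    [AddCommGroup N] [Module B N] (φ : M →+ N)
    (hφ : ∀ (n : ℕ) (x : M), x ∈ (I ^ n • ⊤ : Submodule A M) →
      φ x ∈ (J ^ n • ⊤ : Submodule B N)) :
    AdicCompletion I M →+ AdicCompletion J N where
  toFun x := ⟨fun n => adicQuotientMap φ hφ n (x.val n), by
    intro m n hmn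
    have h := x.property hmn
    obtain ⟨y, hy⟩ := Submodule.Quotient.mk_surjective _ (x.val n)
    change AdicCompletion.transitionMap I M hmn (x.val n) = x.val m at h
    change AdicCompletion.transitionMap J N hmn (adicQuotientMap φ hφ n (x.val n)) =
      adicQuotientMap φ hφ m (x.val m)
    rw [← h, ← hy]
    rfl⟩
  map_zero' := by
    ext n
    exact map_zero (adicQuotientMap φ hφ n)
  map_add' x y := by
    ext n
    exact map_add (adicQuotientMap φ hφ n) (x.val n) (y.val n)

variable {M : Type*} [AddCommGroup M] [Module K M]

/-- The map `I → J` induced by an algebra homomorphism `ψ` with `ψ(I) ⊆ J`. -/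
def idealMap {I : Ideal A} {J : Ideal B} (ψ : A →ₐ[K] B) (h : I ≤ J.comap ψ) : I →ₗ[K] J where
  toFun a := ⟨ψ a, h a.2⟩
  map_add' a b := Subtype.ext (map_add ψ (a : A) b)
  map_smul' c a := Subtype.ext (map_smul ψ c (a : A))

/-- The map `I ⊗ M → J ⊗ M` induced by an algebra homomorphism `ψ` with `ψ(I) ⊆ J`. -/
def idealTensorMap {I : Ideal A} {J : Ideal B} (ψ : A →ₐ[K] B) (h : I ≤ J.comap ψ)
    (M : Type*) [AddCommGroup M] [Module K M] : I ⊗[K] M →ₗ[K] J ⊗[K] M :=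
  (idealMap ψ h).rTensor M

theorem idealTensorMap_smul {I : Ideal A} {J : Ideal B} (ψ : A →ₐ[K] B) (h : I ≤ J.comap ψ)
    (a : A) (x : I ⊗[K] M) :
    idealTensorMap ψ h M (a • x) = ψ a • idealTensorMap ψ h M x := by
  induction x with
  | zero => simp
  | add x y hx hy => simp only [smul_add, map_add, hx, hy]
  | tmul b m =>
    have h1 : idealMap ψ h (a • b) = ψ a • idealMap ψ h b := Subtype.ext (map_mul ψ a (b : A))
    simp only [idealTensorMap, TensorProduct.smul_tmul', LinearMap.rTensor_tmul, h1]

/-- Base change `ψ^* : M ⊗̂ I → M ⊗̂ J` along an algebra homomorphism `ψ` with `ψ(I) ⊆ J`. -/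
def CompletedTensor.map {I : Ideal A} {J : Ideal B} (ψ : A →ₐ[K] B) (h : I ≤ J.comap ψ) :
    CompletedTensor K I M →+ CompletedTensor K J M :=
  adicCompletionMap (idealTensorMap ψ h M).toAddMonoidHom fun n x hx => by
    refine Submodule.smul_induction_on hx (fun a ha y _ => ?_) (fun y z hy hz => ?_)
    · change idealTensorMap ψ h M (a • y) ∈ _
      rw [idealTensorMap_smul]
      refine Submodule.smul_mem_smul ?_ trivial
      have h1 : I ^ n ≤ (J ^ n).comap ψ :=
        (Ideal.pow_right_mono h n).trans (Ideal.le_comap_pow ψ n)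
      exact h1 ha
    · rw [map_add]; exact add_mem hy hz

/-- The ideal `I[t]` of the polynomial ring `A[t]`. -/
abbrev polyIdeal (I : Ideal A) : Ideal (Polynomial A) := I.map Polynomial.C

/-- Evaluation `M ⊗̂ I[t] → M ⊗̂ I` at `t = c`.  Here `M ⊗̂ I[t]` is the completion of
`I[t] ⊗ M` with respect to the ideal `I[t]`; as `I[t]ⁿ = Iⁿ[t]`, this is the same as the completion
with respect to the `I`-adic filtration. -/
def CompletedTensor.evalAt {I : Ideal A} (c : A) :
    CompletedTensor K (polyIdeal I) M →+ CompletedTensor K I M :=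
  CompletedTensor.map ((Polynomial.aeval (R := A) c).restrictScalars K)
    (Ideal.map_le_iff_le_comap.2 fun a ha => by simpa using ha)

theorem derivative_mem_polyIdeal {I : Ideal A} {p : Polynomial A} (hp : p ∈ polyIdeal I) :
    Polynomial.derivative p ∈ polyIdeal I := by
  rw [Ideal.mem_map_C_iff] at hp ⊢
  intro n
  rw [Polynomial.coeff_derivative]
  exact I.mul_mem_right _ (hp _)

/-- The derivative `d/dt` on `I[t]`. -/
def derivativeIdeal (K : Type*) [Field K] [Algebra K A] (I : Ideal A) :
    polyIdeal I →ₗ[K] polyIdeal I where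
  toFun p := ⟨Polynomial.derivative (p : Polynomial A), derivative_mem_polyIdeal p.2⟩
  map_add' p q := Subtype.ext (map_add Polynomial.derivative (p : Polynomial A) q)
  map_smul' c p := Subtype.ext (Polynomial.derivative_smul c (p : Polynomial A))

/-- `d/dt ⊗ id` on `I[t] ⊗ M`. -/
def derivativeTensor (I : Ideal A) (M : Type*) [AddCommGroup M] [Module K M] :
    polyIdeal I ⊗[K] M →ₗ[K] polyIdeal I ⊗[K] M :=
  (derivativeIdeal K I).rTensor M

theorem derivativeTensor_smul (I : Ideal A) (p : Polynomial A) (x : polyIdeal I ⊗[K] M) :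
    derivativeTensor I M (p • x) =
      p • derivativeTensor I M x + Polynomial.derivative p • x := by
  induction x with
  | zero => simp
  | add x y hx hy => simp only [smul_add, map_add, hx, hy]; abel
  | tmul b m =>
    have h1 : derivativeIdeal K I (p • b) =
        p • derivativeIdeal K I b + Polynomial.derivative p • b := by
      refine Subtype.ext ?_
      change Polynomial.derivative (p * (b : Polynomial A)) = _
      rw [Polynomial.derivative_mul, add_comm]
      rfl
    simp only [derivativeTensor, TensorProduct.smul_tmul', LinearMap.rTensor_tmul, h1,
      TensorProduct.add_tmul]

/-- The derivative `d/dt` on `M ⊗̂ I[t]`. -/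
def CompletedTensor.deriv {I : Ideal A} :
    CompletedTensor K (polyIdeal I) M →+ CompletedTensor K (polyIdeal I) M :=
  adicCompletionMap (derivativeTensor I M).toAddMonoidHom fun n x hx => by
    refine Submodule.smul_induction_on hx (fun a ha y _ => ?_) (fun y z hy hz => ?_)
    · change derivativeTensor I M (a • y) ∈ _
      rw [derivativeTensor_smul]
      refine add_mem (Submodule.smul_mem_smul ha trivial) (Submodule.smul_mem_smul ?_ trivial)
      have h1 : polyIdeal I ^ n = polyIdeal (I ^ n) := (Ideal.map_pow _ _ _).symm
      rw [h1] at ha ⊢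
      exact derivative_mem_polyIdeal ha
    · rw [map_add]; exact add_mem hy hz

variable {V : Type*} [AddCommGroup V] [Module K V]

/-- For a subspace `P` of `V`, the natural map `I ⊗ P → (A / Iⁿ) ⊗ V`. -/
def reduceAux (I : Ideal A) (P : Submodule K V) (n : ℕ) :
    I ⊗[K] P →ₗ[A] (A ⧸ I ^ n) ⊗[K] V :=
  TensorProduct.AlgebraTensorModule.map ((I ^ n).mkQ ∘ₗ Submodule.subtype I) P.subtype

/-- For a subspace `P` of `V`, the natural map `P ⊗̂ I → (A / Iⁿ) ⊗ V`, "reduction modulo `Iⁿ`". -/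
def CompletedTensor.reduce {I : Ideal A} {P : Submodule K V} (n : ℕ) :
    CompletedTensor K I P →ₗ[A] (A ⧸ I ^ n) ⊗[K] V :=
  Submodule.liftQ (I ^ n • ⊤ : Submodule A (I ⊗[K] P)) (reduceAux I P n) (by
    refine Submodule.smul_le.2 fun a ha y _ => ?_
    rw [LinearMap.mem_ker, map_smul]
    induction reduceAux I P n y with
    | zero => simp
    | add x y hx hy => rw [smul_add, hx, hy, add_zero]
    | tmul b m =>
      rw [TensorProduct.smul_tmul']
      obtain ⟨b, rfl⟩ := Ideal.Quotient.mk_surjective b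
      have : a • (Ideal.Quotient.mk (I ^ n) b) = 0 :=
        Ideal.Quotient.eq_zero_iff_mem.2 (Ideal.mul_mem_right b _ ha)
      rw [this, TensorProduct.zero_tmul]) ∘ₗ AdicCompletion.eval I (I ⊗[K] P) n

/-- The natural map `M ⊗̂ I → (I / I²) ⊗ M`. -/
def CompletedTensor.toCotangent {I : Ideal A} :
    CompletedTensor K I M →ₗ[A] I.Cotangent ⊗[K] M :=
  Submodule.liftQ (I ^ 1 • ⊤ : Submodule A (I ⊗[K] M))
    (TensorProduct.AlgebraTensorModule.map I.toCotangent (LinearMap.id : M →ₗ[K] M)) (by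
    refine Submodule.smul_le.2 fun a ha y _ => ?_
    rw [pow_one] at ha
    rw [LinearMap.mem_ker]
    induction y with
    | zero => simp
    | add x y hx hy => rw [smul_add, map_add, hx trivial, hy trivial, add_zero]
    | tmul b m =>
      rw [TensorProduct.smul_tmul', TensorProduct.AlgebraTensorModule.map_tmul]
      have : I.toCotangent (a • b) = 0 := by
        rw [Ideal.toCotangent_eq_zero, pow_two]
        exact Ideal.mul_mem_mul ha b.2
      rw [this, TensorProduct.zero_tmul]) ∘ₗ AdicCompletion.eval I (I ⊗[K] M) 1

/-- Contraction of an element of `(I / I²) ⊗ M` with elements of `(I / I²)^*`. -/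
def contractCotangent {I : Ideal A} (x : I.Cotangent ⊗[K] M) :
    Module.Dual K I.Cotangent →ₗ[K] M where
  toFun l := TensorProduct.lid K M (l.rTensor M x)
  map_add' l l' := by simp [LinearMap.rTensor_add]
  map_smul' c l := by simp [LinearMap.rTensor_smul]

end CompletedTensor

namespace LInfinityAlgebra

variable {K : Type*} [Field K] {V : Type*} [AddCommGroup V] [Module K V]
  (g : LInfinityAlgebra K V)

/-- The differential `ℓ¹`. -/
def diff : V →ₗ[K] V := (MultilinearMap.ofSubsingleton K V V (0 : Fin 1)).symm (g.bracket 1)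

theorem diff_apply (v : V) : g.diff v = g.bracket 1 fun _ => v := rfl

/-- The closed elements of degree `i`. -/
def cocycles (i : ℤ) : Submodule K V := g.grading i ⊓ LinearMap.ker g.diff

/-- The exact elements of degree `i`. -/
def coboundaries (i : ℤ) : Submodule K V := (g.grading (i - 1)).map g.diff

/-- The cohomology `Hⁱ(𝔤)` of `(𝔤, ℓ¹)`. -/
abbrev Cohomology (i : ℤ) : Type _ :=
  g.cocycles i ⧸ (g.coboundaries i).submoduleOf (g.cocycles i)

/-- The extension of `ℓˢ` to `A ⊗ 𝔤`. -/
def bracketOver (A : Type*) [CommRing A] [Algebra K A] (s : ℕ) :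
    MultilinearMap A (fun _ : Fin s => A ⊗[K] V) (A ⊗[K] V) :=
  multilinearBaseChange A s (g.bracket s)

section MaurerCartan

variable {A : Type*} [CommRing A] [Algebra K A]

/-- `α ∈ 𝔤¹ ⊗̂ I` satisfies the Maurer--Cartan equation `∑_{s ≥ 1} {α, …, α} / s! = 0`.
The sum converges `I`-adically: modulo `Iⁿ` the terms with `s ≥ n` vanish, and the
equation says that the resulting finite sum is zero modulo `Iⁿ` for every `n`. -/
def IsMaurerCartan {I : Ideal A} (α : CompletedTensor K I (g.grading 1)) : Prop :=
  ∀ n : ℕ, ∑ s ∈ Finset.Icc 1 n, ((s.factorial : K)⁻¹) •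
    g.bracketOver (A ⧸ I ^ n) s (fun _ => CompletedTensor.reduce n α) = 0

/-- The set of Maurer--Cartan elements in `𝔤¹ ⊗̂ I`. -/
def MCIdeal (I : Ideal A) : Set (CompletedTensor K I (g.grading 1)) := {α | g.IsMaurerCartan α}

/-- `MC_𝔤(R)` for a local `K`-algebra `(R, 𝔪)`. -/
abbrev MC (R : Type*) [CommRing R] [IsLocalRing R] [Algebra K R] :
    Set (CompletedTensor K (IsLocalRing.maximalIdeal R) (g.grading 1)) :=
  g.MCIdeal (IsLocalRing.maximalIdeal R)

/-- `α₀` and `α₁` are joined by a flowline `a(t)`, `0 ≤ t ≤ 1`, of a vector field `v(γ, t)`: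
`a ∈ 𝔤¹ ⊗̂ I[t]` and `γ ∈ 𝔤⁰ ⊗̂ I[t]` satisfy
`a'(t) = ∑_{i ≥ 0} {γ(t), a(t), …, a(t)} / i!`  (`i` copies of `a(t)`), `a(0) = α₀`, `a(1) = α₁`.
The sum converges adically: its terms with `i ≥ n` vanish modulo the `n`-th power. -/
def IsFlowline {I : Ideal A} (α₀ α₁ : CompletedTensor K I (g.grading 1)) : Prop :=
  ∃ (γ : CompletedTensor K (polyIdeal I) (g.grading 0))
    (a : CompletedTensor K (polyIdeal I) (g.grading 1)),
    (∀ n : ℕ, CompletedTensor.reduce n (CompletedTensor.deriv a) =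
      ∑ i ∈ Finset.range n, ((i.factorial : K)⁻¹) •
        g.bracketOver (Polynomial A ⧸ polyIdeal I ^ n) (i + 1)
          (Fin.cons (CompletedTensor.reduce n γ) fun _ => CompletedTensor.reduce n a)) ∧
    CompletedTensor.evalAt 0 a = α₀ ∧ CompletedTensor.evalAt 1 a = α₁

/-- Gauge equivalence: `α` and `α'` are connected by a finite series of flowlines.  (Flowlines that
start at a Maurer--Cartan element stay in the set of Maurer--Cartan elements.) -/
def GaugeEquiv {I : Ideal A} (α α' : CompletedTensor K I (g.grading 1)) : Prop :=
  Relation.EqvGen g.IsFlowline α α'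

end MaurerCartan

section Versality

variable {S : Type*} [CommRing S] [IsLocalRing S] [Algebra K S]

open IsLocalRing in
/-- `α ∈ MC_𝔤(S)` is complete if, for every complete Noetherian local `K`-algebra `R`,
any `β ∈ MC_𝔤(R)` is gauge equivalent to `ψ^* α` for some local homomorphism of `K`-algebras
`ψ : S → R`. -/
def IsCompleteMC (α : g.MC S) : Prop :=
  ∀ (R : Type w) [CommRing R] [IsLocalRing R] [IsNoetherianRing R]
    [IsAdicComplete (maximalIdeal R) R] [Algebra K R] (β : g.MC R),
    ∃ (ψ : S →ₐ[K] R) (h : maximalIdeal S ≤ (maximalIdeal R).comap ψ),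
      g.GaugeEquiv β.1 (CompletedTensor.map ψ h α.1)

open IsLocalRing in
/-- `α ∈ MC_𝔤(S)` is versal if it is complete and, for every `β ∈ MC_𝔤(R)`, the map
`𝔪_S / 𝔪_S² → 𝔪_R / 𝔪_R²` induced by a local homomorphism `ψ` with `β ∼ ψ^* α` is uniquely
determined. -/
def IsVersalMC (α : g.MC S) : Prop :=
  IsCompleteMC.{w} g α ∧
  ∀ (R : Type w) [CommRing R] [IsLocalRing R] [IsNoetherianRing R]
    [IsAdicComplete (maximalIdeal R) R] [Algebra K R] (β : g.MC R)
    (ψ ψ' : S →ₐ[K] R) (h : maximalIdeal S ≤ (maximalIdeal R).comap ψ)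
    (h' : maximalIdeal S ≤ (maximalIdeal R).comap ψ'),
      g.GaugeEquiv β.1 (CompletedTensor.map ψ h α.1) →
      g.GaugeEquiv β.1 (CompletedTensor.map ψ' h' α.1) →
      Ideal.mapCotangent (maximalIdeal S) (maximalIdeal R) ψ h =
        Ideal.mapCotangent (maximalIdeal S) (maximalIdeal R) ψ' h'

end Versality

section KodairaSpencer

variable {A : Type*} [CommRing A] [Algebra K A]

theorem bracketOver_one_eq (B : Type*) [CommRing B] [Algebra K B] (x : B ⊗[K] V) :
    g.bracketOver B 1 (fun _ => x) = g.diff.lTensor B x := by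
  change (MultilinearMap.ofSubsingleton B (B ⊗[K] V) (B ⊗[K] V) (0 : Fin 1)).symm
    (g.bracketOver B 1) x = _
  induction x with
  | zero => rw [map_zero, map_zero]
  | add x y hx hy => rw [map_add, map_add, hx, hy]
  | tmul b v =>
    have h := multilinearBaseChange_tmul B 1 (g.bracket 1) (fun _ => b) (fun _ => v)
    rw [Fin.prod_univ_one] at h
    exact h

theorem bracketOver_two_eq_zero {I : Ideal A} (P : Submodule K V) (y y' : I ⊗[K] P) :
    g.bracketOver (A ⧸ I ^ 2) 2 (Fin.cons (reduceAux I P 2 y) fun _ => reduceAux I P 2 y') = 0 := by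
  change (MultilinearMap.ofSubsingleton (A ⧸ I ^ 2) ((A ⧸ I ^ 2) ⊗[K] V)
        ((A ⧸ I ^ 2) ⊗[K] V) (0 : Fin 1)).symm
        ((g.bracketOver (A ⧸ I ^ 2) 2).curryLeft (reduceAux I P 2 y)) (reduceAux I P 2 y') = 0
  induction y' with
  | zero => rw [map_zero, map_zero]
  | add x z hx hz => rw [map_add, map_add, hx, hz, add_zero]
  | tmul b w =>
    change (g.bracketOver (A ⧸ I ^ 2) 2).curryLeft (reduceAux I P 2 y)
      (fun _ => reduceAux I P 2 (b ⊗ₜ w)) = 0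
    induction y with
    | zero => rw [map_zero, map_zero]; rfl
    | add x z hx hz => rw [map_add, map_add, add_apply, hx, hz, add_zero]
    | tmul a v =>
      have h := multilinearBaseChange_tmul (A ⧸ I ^ 2) 2 (g.bracket 2)
        ![Ideal.Quotient.mk (I ^ 2) (a : A), Ideal.Quotient.mk (I ^ 2) (b : A)] ![(v : V), (w : V)]
      have h0 : (∏ i, ![Ideal.Quotient.mk (I ^ 2) (a : A),
          Ideal.Quotient.mk (I ^ 2) (b : A)] i) = 0 := by
        rw [Fin.prod_univ_two]
        change Ideal.Quotient.mk (I ^ 2) (a : A) * Ideal.Quotient.mk (I ^ 2) (b : A) = 0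
        rw [← map_mul, Ideal.Quotient.eq_zero_iff_mem, pow_two]
        exact Ideal.mul_mem_mul a.2 b.2
      rw [h0, TensorProduct.zero_tmul] at h
      rw [← h]
      rw [MultilinearMap.curryLeft_apply]
      refine congrArg (multilinearBaseChange (A ⧸ I ^ 2) 2 (g.bracket 2)) ?_
      funext i
      fin_cases i <;> rfl

/-- The Maurer--Cartan equation modulo `I²` shows that the contractions of the projection of `α` to
`(I / I²) ⊗ 𝔤¹` are closed. -/
theorem contract_mem_cocycles {I : Ideal A} (α : g.MCIdeal I) (l : Module.Dual K I.Cotangent) :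
    (contractCotangent (CompletedTensor.toCotangent α.1) l : V) ∈ g.cocycles 1 := by
  refine ⟨Subtype.mem _, ?_⟩
  obtain ⟨α, hα⟩ := α
  obtain ⟨y, hy⟩ := Submodule.Quotient.mk_surjective _ (α.val 2)
  have hy1 : Submodule.Quotient.mk y = α.val 1 := by
    have h := α.property (show 1 ≤ 2 by norm_num)
    change AdicCompletion.transitionMap I _ _ (α.val 2) = α.val 1 at h
    rw [← h, ← hy]
    rfl
  have hred : CompletedTensor.reduce 2 α =
      reduceAux I (g.grading 1) 2 y := by
    rw [CompletedTensor.reduce, LinearMap.comp_apply, AdicCompletion.eval_apply, ← hy]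
    rfl
  have hcot : CompletedTensor.toCotangent α =
      TensorProduct.AlgebraTensorModule.map I.toCotangent
        (LinearMap.id : g.grading 1 →ₗ[K] g.grading 1) y := by
    rw [CompletedTensor.toCotangent, LinearMap.comp_apply, AdicCompletion.eval_apply, ← hy1]
    rfl
  obtain ⟨r, hr⟩ := LinearMap.exists_leftInverse_of_injective
    (I.cotangentToQuotientSquare.restrictScalars K)
    (LinearMap.ker_eq_bot.2 I.cotangentToQuotientSquare_injective)
  have hμ : ∀ a : I, (l ∘ₗ r) (Ideal.Quotient.mk (I ^ 2) (a : A)) = l (I.toCotangent a) :=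
    fun a => congrArg l (LinearMap.congr_fun hr (I.toCotangent a))
  have hmc := hα 2
  rw [show Finset.Icc 1 2 = {1, 2} from rfl, Finset.sum_pair (by norm_num)] at hmc
  have h2 : g.bracketOver (A ⧸ I ^ 2) 2 (fun _ => CompletedTensor.reduce 2 α) = 0 := by
    rw [← g.bracketOver_two_eq_zero (g.grading 1) y y]
    refine congrArg (g.bracketOver (A ⧸ I ^ 2) 2) ?_
    funext i
    fin_cases i <;> exact hred
  rw [h2, smul_zero, add_zero, Nat.factorial_one, Nat.cast_one, inv_one, one_smul,
    bracketOver_one_eq] at hmc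
  have hmc' : g.diff.lTensor (A ⧸ I ^ 2) (reduceAux I (g.grading 1) 2 y) = 0 := by
    rw [← hred]; exact hmc
  have hkey : g.diff (contractCotangent (CompletedTensor.toCotangent α) l : V) = TensorProduct.lid K V ((l ∘ₗ r).rTensor V
        (g.diff.lTensor (A ⧸ I ^ 2) (reduceAux I (g.grading 1) 2 y))) := by
    rw [hcot]
    clear hmc' hcot hred hy1 hy h2 hmc
    induction y with
    | zero => simp [contractCotangent]
    | add x z hx hz =>
      simp only [map_add, ← hx, ← hz]
      simp [contractCotangent]
    | tmul a v =>
      change g.diff ((l (I.toCotangent a) • v : g.grading 1) : V) =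
        (l ∘ₗ r) (Ideal.Quotient.mk (I ^ 2) (a : A)) • g.diff v
      rw [hμ, Submodule.coe_smul, map_smul]
  rw [hmc', map_zero, map_zero] at hkey
  exact hkey

/-- The Kodaira--Spencer map `(I / I²)^* → H¹(𝔤)`, the contraction with the class of the
projection of `α` to `(I / I²) ⊗ 𝔤¹`. -/
def kodairaSpencer {I : Ideal A} (α : g.MCIdeal I) :
    Module.Dual K I.Cotangent →ₗ[K] g.Cohomology 1 :=
  ((g.coboundaries 1).submoduleOf (g.cocycles 1)).mkQ ∘ₗ
    ((g.grading 1).subtype ∘ₗ contractCotangent (CompletedTensor.toCotangent α.1)).codRestrict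
      (g.cocycles 1) (g.contract_mem_cocycles α)

end KodairaSpencer

end LInfinityAlgebra

end

/-! Completeness is proved by solving for the gauge flowline order by order. Given a Maurer-Cartan
element `η`, the unknowns are the images of the variables under `ψ`, a generator `γ(t)` and a path
`a(t)` from `η` to `ψ^* β`. Modulo `I` the zero data work. Suppose they work modulo `I ^ n`.
Integrating in `t` the defect of the flow equation and shifting by a constant gives a path that
starts at `η` and solves the equation modulo `I ^ (n + 1)` (`flowSum_sub_sub_diff_mem`). The flow
preserves the Maurer-Cartan equation (`mcSum_mem_of_flow`), so the endpoint and `ψ^* β` are two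
solutions modulo `I ^ (n + 1)` whose difference `u` has order `n`. Linearising the equation shows
that `ℓ¹ u` has order `n + 1` (`mcSum_sub_sub_diff_mem`).

Surjectivity of the Kodaira-Spencer map says that the first order coefficients `b i` of `β` span
`H¹`. Hence `u` is, up to order `n + 1`, a sum of terms `c i ⊗ b i` plus `ℓ¹ δ`, with all `c i` and
`δ` of order `n` (`exists_decomposition`). The first part is absorbed by adding `c i` to the image
of the `i`-th variable, which is possible because homomorphisms out of a power series algebra are
free on the variables; the second by replacing `γ` with `γ - δ`. There is no obstruction, and
`ApproxFlowline.exists_succ` is this step. The corrections at stage `n` have order `n`, so the data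
converge to one exact flowline.

That the flow preserves Maurer-Cartan elements is a Gronwall argument. By the `L∞` relations for
`(γ, x, …, x)`, the curvature `F` of the path satisfies the linear equation `F' = -∑ {F, γ, x, …, x}
/ l!`. As `γ` has order one, `F` of order `k` forces `F'` of order `k + 1`, and integration from
`F(0)` raises the order of `F`.

For versality, modulo `I ^ 2` the flow equation is `a' = ℓ¹ γ`, so the first order class in `H¹` is
a gauge invariant (`IsFlowline.contract_sub_mem`). For `ψ^* β` this class is `KS_β` composed with
the transpose of the cotangent map of `ψ`; injectivity of `KS_β` recovers that map. -/

noncomputable section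

/-! ### The adic filtration on `A ⊗ V`. -/

section Filtration

variable {K : Type*} [Field K] {A B : Type*} [CommRing A] [Algebra K A] [CommRing B] [Algebra K B]
  {V W : Type*} [AddCommGroup V] [Module K V] [AddCommGroup W] [Module K W]

/-- The `I`-adic filtration of `A ⊗ V`. -/
def adicFil (K : Type*) [Field K] {A : Type*} [CommRing A] [Algebra K A] (V : Type*)
    [AddCommGroup V] [Module K V] (I : Ideal A) (n : ℕ) : Submodule A (A ⊗[K] V) := I ^ n • ⊤

theorem adicFil_anti {I : Ideal A} {m n : ℕ} (h : m ≤ n) : adicFil K V I n ≤ adicFil K V I m :=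
  Submodule.smul_mono_left (Ideal.pow_le_pow_right h)

theorem adicFil_zero (I : Ideal A) : adicFil K V I 0 = ⊤ := by simp [adicFil]

theorem tmul_mem_adicFil {I : Ideal A} {n : ℕ} {a : A} (ha : a ∈ I ^ n) (v : V) :
    a ⊗ₜ[K] v ∈ adicFil K V I n := by
  have : a ⊗ₜ[K] v = a • ((1 : A) ⊗ₜ[K] v) := by rw [TensorProduct.smul_tmul', smul_eq_mul, mul_one]
  rw [this]
  exact Submodule.smul_mem_smul ha trivial

@[elab_as_elim]
theorem adicFil_induction {I : Ideal A} {n : ℕ} {p : A ⊗[K] V → Prop} {x : A ⊗[K] V}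
    (hx : x ∈ adicFil K V I n) (tmul : ∀ a ∈ I ^ n, ∀ v, p (a ⊗ₜ[K] v))
    (add : ∀ x y, p x → p y → p (x + y)) : p x := by
  refine Submodule.smul_induction_on hx (fun a ha y _ => ?_) add
  induction y with
  | zero => simpa using tmul 0 (zero_mem _) 0
  | add x y hx hy => rw [smul_add]; exact add _ _ (hx trivial) (hy trivial)
  | tmul b v =>
    rw [TensorProduct.smul_tmul']
    exact tmul _ ((I ^ n).mul_mem_right _ ha) _

theorem rTensor_mem_adicFil {I : Ideal A} {J : Ideal B} {m n : ℕ} {φ : A →ₗ[K] B}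
    (hφ : ∀ a ∈ I ^ n, φ a ∈ J ^ m) {x : A ⊗[K] V} (hx : x ∈ adicFil K V I n) :
    φ.rTensor V x ∈ adicFil K V J m := by
  refine adicFil_induction hx (fun a ha v => ?_) (fun x y hx hy => ?_)
  · rw [LinearMap.rTensor_tmul]; exact tmul_mem_adicFil (hφ a ha) v
  · rw [map_add]; exact add_mem hx hy

theorem lTensor_mem_adicFil {I : Ideal A} {n : ℕ} (f : V →ₗ[K] W) {x : A ⊗[K] V}
    (hx : x ∈ adicFil K V I n) : f.lTensor A x ∈ adicFil K W I n := by
  refine adicFil_induction hx (fun a ha v => ?_) (fun x y hx hy => ?_)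
  · rw [LinearMap.lTensor_tmul]; exact tmul_mem_adicFil ha _
  · rw [map_add]; exact add_mem hx hy

theorem rTensor_eq_zero_of_mem_adicFil {I : Ideal A} {n : ℕ} {φ : A →ₗ[K] B}
    (hφ : ∀ a ∈ I ^ n, φ a = 0) {x : A ⊗[K] V} (hx : x ∈ adicFil K V I n) :
    φ.rTensor V x = 0 := by
  refine adicFil_induction hx (fun a ha v => ?_) (fun x y hx hy => ?_)
  · rw [LinearMap.rTensor_tmul, hφ a ha, TensorProduct.zero_tmul]
  · rw [map_add, hx, hy, add_zero]

/-- Reduction `A ⊗ V → (A / Iⁿ) ⊗ V`. -/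
def adicRed (K : Type*) [Field K] {A : Type*} [CommRing A] [Algebra K A] (V : Type*)
    [AddCommGroup V] [Module K V] (I : Ideal A) (n : ℕ) : A ⊗[K] V →ₗ[K] (A ⧸ I ^ n) ⊗[K] V :=
  (Ideal.Quotient.mkₐ K (I ^ n)).toLinearMap.rTensor V

/-- Right exactness of the tensor product. It turns every equation in `(A ⧸ I ^ n) ⊗ V` into a
membership for representatives in `A ⊗ V`, the form in which all congruences are handled. -/
theorem adicRed_eq_zero_iff {I : Ideal A} {n : ℕ} {x : A ⊗[K] V} :
    adicRed K V I n x = 0 ↔ x ∈ adicFil K V I n := by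
  constructor
  · intro h
    have hex : Function.Exact ((I ^ n).restrictScalars K).subtype
        (Ideal.Quotient.mkₐ K (I ^ n)).toLinearMap := by
      intro a
      simp [Ideal.Quotient.eq_zero_iff_mem]
    obtain ⟨y, rfl⟩ := (rTensor_exact V hex (Ideal.Quotient.mkₐ_surjective K (I ^ n)) x).1 h
    induction y with
    | zero => simp
    | add x y hx hy =>
      have hz : ∀ z, adicRed K V I n (((I ^ n).restrictScalars K).subtype.rTensor V z) = 0 :=
        fun z => (rTensor_exact V hex (Ideal.Quotient.mkₐ_surjective K (I ^ n)) _).2 ⟨z, rfl⟩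
      rw [map_add]; exact add_mem (hx (hz x)) (hy (hz y))
    | tmul a v => rw [LinearMap.rTensor_tmul]; exact tmul_mem_adicFil a.2 v
  · exact rTensor_eq_zero_of_mem_adicFil fun a ha => Ideal.Quotient.eq_zero_iff_mem.2 ha

theorem adicRed_eq_iff {I : Ideal A} {n : ℕ} {x y : A ⊗[K] V} :
    adicRed K V I n x = adicRed K V I n y ↔ x - y ∈ adicFil K V I n := by
  rw [← adicRed_eq_zero_iff, map_sub, sub_eq_zero]

@[elab_as_elim]
theorem baseChange_induction {P : Submodule K V} {p : A ⊗[K] V → Prop} {x : A ⊗[K] V}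
    (hx : x ∈ P.baseChange A) (tmul : ∀ a : A, ∀ v ∈ P, p (a ⊗ₜ[K] v))
    (add : ∀ x y, p x → p y → p (x + y)) : p x := by
  obtain ⟨y, hy⟩ := P.toBaseChange_surjective A ⟨x, hx⟩
  obtain rfl : (P.toBaseChange A y : A ⊗[K] V) = x := congrArg Subtype.val hy
  clear hy hx
  induction y with
  | zero => simpa using tmul 0 0 P.zero_mem
  | add x y hx hy => rw [map_add]; exact add _ _ hx hy
  | tmul a v => exact tmul a v v.2

theorem rTensor_mem_baseChange {φ : A →ₗ[K] B} {P : Submodule K V} {x : A ⊗[K] V}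
    (hx : x ∈ P.baseChange A) : φ.rTensor V x ∈ P.baseChange B := by
  refine baseChange_induction hx (fun a v hv => ?_) (fun x y hx hy => ?_)
  · exact Submodule.tmul_mem_baseChange_of_mem _ hv
  · rw [map_add]; exact add_mem hx hy

theorem lTensor_mem_baseChange {f : V →ₗ[K] W} {P : Submodule K V} {Q : Submodule K W}
    (hf : ∀ v ∈ P, f v ∈ Q) {x : A ⊗[K] V} (hx : x ∈ P.baseChange A) :
    f.lTensor A x ∈ Q.baseChange A := by
  refine baseChange_induction hx (fun a v hv => ?_) (fun x y hx hy => ?_)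
  · exact Submodule.tmul_mem_baseChange_of_mem _ (hf v hv)
  · rw [map_add]; exact add_mem hx hy

theorem lTensor_eqOn_baseChange {f f' : V →ₗ[K] W} {P : Submodule K V}
    (hf : ∀ v ∈ P, f v = f' v) {x : A ⊗[K] V} (hx : x ∈ P.baseChange A) :
    f.lTensor A x = f'.lTensor A x := by
  refine baseChange_induction hx (fun a v hv => ?_) (fun x y hx hy => ?_)
  · exact congrArg (a ⊗ₜ[K] ·) (hf v hv)
  · rw [map_add, map_add, hx, hy]

/-- An element of `A ⊗ P` which lies in the `n`-th step of the adic filtration of `A ⊗ V` is a sum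
of pure tensors `a ⊗ v` with `a ∈ Iⁿ` and `v ∈ P`. -/
@[elab_as_elim]
theorem adicFil_baseChange_induction {I : Ideal A} {n : ℕ} {P : Submodule K V}
    {p : A ⊗[K] V → Prop} {x : A ⊗[K] V} (hx : x ∈ adicFil K V I n) (hP : x ∈ P.baseChange A)
    (tmul : ∀ a ∈ I ^ n, ∀ v ∈ P, p (a ⊗ₜ[K] v)) (add : ∀ x y, p x → p y → p (x + y)) : p x := by
  -- A linear retraction of `V` onto `P` fixes `x` and moves the vectors of any decomposition into
  -- `P` while leaving the coefficients in `I ^ n`.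
  obtain ⟨r, hr⟩ := LinearMap.exists_leftInverse_of_injective P.subtype (Submodule.ker_subtype P)
  have hr' : ∀ v ∈ P, (P.subtype ∘ₗ r) v = (LinearMap.id : V →ₗ[K] V) v := fun v hv =>
    congrArg Subtype.val (LinearMap.congr_fun hr ⟨v, hv⟩)
  have h := lTensor_eqOn_baseChange hr' hP
  rw [LinearMap.lTensor_id, LinearMap.id_apply] at h
  rw [← h]
  clear h hP
  refine adicFil_induction hx (fun a ha v => ?_) (fun x y hx hy => ?_)
  · exact tmul a ha _ (r v).2
  · rw [map_add]; exact add _ _ hx hy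

end Filtration

/-! ### Multilinear maps and filtration orders. -/

section Multilinear

variable {A : Type*} [CommRing A] {M N : Type*} [AddCommGroup M] [Module A M]
  [AddCommGroup N] [Module A N]

/-- Scalars come out of every slot, so orders add. This is the source of all convergence: a bracket
of `s` elements of order one has order `s`. -/
theorem multilinear_mem_pow_smul {I : Ideal A} {s : ℕ} (f : MultilinearMap A (fun _ : Fin s => M) N)
    (e : Fin s → ℕ) (v : Fin s → M) (hv : ∀ i, v i ∈ (I ^ e i • ⊤ : Submodule A M)) :
    f v ∈ (I ^ (∑ i, e i) • ⊤ : Submodule A N) := by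
  induction s with
  | zero => simp
  | succ s ih =>
    have key : ∀ x ∈ (I ^ e 0 • ⊤ : Submodule A M),
        f.curryLeft x (Fin.tail v) ∈ (I ^ (∑ i, e i) • ⊤ : Submodule A N) := by
      intro x hx
      refine Submodule.smul_induction_on hx (fun a ha y _ => ?_) (fun x y hx hy => ?_)
      · rw [map_smul, smul_apply, Fin.sum_univ_succ, pow_add, Submodule.mul_smul]
        exact Submodule.smul_mem_smul ha
          (ih (f.curryLeft y) (fun i => e i.succ) (Fin.tail v) fun i => hv i.succ)
      · rw [map_add, add_apply]; exact add_mem hx hy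
    have := key (v 0) (hv 0)
    rwa [MultilinearMap.curryLeft_apply, Fin.cons_self_tail] at this

/-- If the entries of `v` and `w` lie in the filtration steps `e i` and agree up to `n` steps
further, so do the values of a multilinear map. -/
theorem multilinear_sub_mem_pow_smul {I : Ideal A} {s : ℕ}
    (f : MultilinearMap A (fun _ : Fin s => M) N) (e : Fin s → ℕ) (n : ℕ) (v w : Fin s → M)
    (hw : ∀ i, w i ∈ (I ^ e i • ⊤ : Submodule A M))
    (hvw : ∀ i, v i - w i ∈ (I ^ (e i + n) • ⊤ : Submodule A M)) :
    f v - f w ∈ (I ^ (∑ i, e i + n) • ⊤ : Submodule A N) := by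
  classical
  have hv : v = w + (v - w) := by simp
  have hanti : ∀ {p q : ℕ} {L : Type _} [AddCommGroup L] [Module A L], p ≤ q →
      (I ^ q • ⊤ : Submodule A L) ≤ I ^ p • ⊤ := fun h =>
    Submodule.smul_mono_left (Ideal.pow_le_pow_right h)
  -- Expand over the set `T` of slots that keep `w`. The term `T = univ` is `f w`; every other term
  -- has a slot filled by `v - w`, which contributes the extra `n`.
  rw [hv, f.map_add_univ, ← Finset.sum_erase_add _ _ (Finset.mem_univ Finset.univ)]
  have h1 : f (Finset.univ.piecewise w (v - w)) = f w := by simp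
  rw [h1, add_sub_cancel_right]
  refine sum_mem fun T hT => ?_
  have hT' : T ≠ Finset.univ := (Finset.mem_erase.1 hT).1
  obtain ⟨i, hi⟩ : ∃ i, i ∉ T := by
    by_contra h
    push Not at h
    exact hT' (Finset.eq_univ_iff_forall.2 h)
  have h2 := multilinear_mem_pow_smul (I := I) f (fun j => if j ∈ T then e j else e j + n)
    (T.piecewise w (v - w)) fun j => by
      by_cases hj : j ∈ T
      · simpa [hj] using hw j
      · simpa [hj] using hvw j
  refine hanti ?_ h2
  have h3 : ∀ j, e j + (if j = i then n else 0) ≤ if j ∈ T then e j else e j + n := by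
    intro j
    by_cases hj : j ∈ T
    · have : j ≠ i := fun h => hi (h ▸ hj)
      simp [hj, this]
    · simp only [hj, if_false]; split_ifs <;> omega
  calc ∑ j, e j + n = ∑ j, (e j + if j = i then n else 0) := by
        rw [Finset.sum_add_distrib]; simp
    _ ≤ _ := Finset.sum_le_sum fun j _ => h3 j

/-- A multilinear map which vanishes on products of generating sets vanishes on products of the
spans. -/
theorem multilinear_eq_zero_of_span {s : ℕ} (f : MultilinearMap A (fun _ : Fin s => M) N)
    (S : Fin s → Set M) (hf : ∀ v : Fin s → M, (∀ i, v i ∈ S i) → f v = 0)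
    (v : Fin s → M) (hv : ∀ i, v i ∈ Submodule.span A (S i)) : f v = 0 := by
  induction s with
  | zero => exact hf v fun i => i.elim0
  | succ s ih =>
    have key : ∀ x ∈ Submodule.span A (S 0), f.curryLeft x (Fin.tail v) = 0 := by
      intro x hx
      induction hx using Submodule.span_induction with
      | mem x hx =>
        refine ih (f.curryLeft x) (fun i => S i.succ) (fun u hu => ?_) _ fun i => hv i.succ
        refine hf _ fun i => ?_
        refine Fin.cases ?_ (fun i => ?_) i
        · simpa using hx
        · simpa using hu i
      | zero => simp
      | add x y _ _ hx hy => rw [map_add, add_apply, hx, hy, add_zero]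
      | smul a x _ hx => rw [map_smul, smul_apply, hx, smul_zero]
    have := key (v 0) (hv 0)
    rwa [MultilinearMap.curryLeft_apply, Fin.cons_self_tail] at this

end Multilinear
end

noncomputable section

/-! ### Elements of the completion through representatives in `A ⊗ V`. -/

section CompletedTensorReps

variable {K : Type*} [Field K] {A B : Type*} [CommRing A] [Algebra K A] [CommRing B] [Algebra K B]
  {V : Type*} [AddCommGroup V] [Module K V]

/-- The inclusion `I ⊗ P → A ⊗ V`. -/
def tensorIncl (I : Ideal A) (P : Submodule K V) : I ⊗[K] P →ₗ[A] A ⊗[K] V :=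
  TensorProduct.AlgebraTensorModule.map (Submodule.subtype I) P.subtype

variable {I : Ideal A} {J : Ideal B} {P : Submodule K V}

theorem tensorIncl_tmul (a : I) (v : P) :
    tensorIncl I P (a ⊗ₜ v) = (a : A) ⊗ₜ[K] (v : V) := rfl

/-- Everything is flat over a field. Computations can therefore take place in `A ⊗ V`, where
brackets are defined, and be carried back to `I ⊗ P`. -/
theorem tensorIncl_injective : Function.Injective (tensorIncl I P) := by
  have : (tensorIncl I P : I ⊗[K] P → A ⊗[K] V) =
      TensorProduct.map ((Submodule.subtype I).restrictScalars K) P.subtype := rfl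
  rw [this]
  exact TensorProduct.map_injective_of_flat_flat _ _ Subtype.val_injective Subtype.val_injective

theorem reduceAux_eq (n : ℕ) (y : I ⊗[K] P) :
    reduceAux I P n y = adicRed K V I n (tensorIncl I P y) := by
  induction y with
  | zero => simp
  | add x y hx hy => simp only [map_add, hx, hy]
  | tmul a v => rfl

theorem tensorIncl_mem_baseChange (y : I ⊗[K] P) : tensorIncl I P y ∈ P.baseChange A := by
  induction y with
  | zero => simp
  | add x y hx hy => rw [map_add]; exact add_mem hx hy
  | tmul a v => exact Submodule.tmul_mem_baseChange_of_mem _ v.2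

theorem tensorIncl_mem_adicFil_one (y : I ⊗[K] P) : tensorIncl I P y ∈ adicFil K V I 1 := by
  induction y with
  | zero => simp
  | add x y hx hy => rw [map_add]; exact add_mem hx hy
  | tmul a v => exact tmul_mem_adicFil (by simp) _

/-- The orders are shifted by one because `I ⊗ P` already carries a factor of `I`: split `I ^ (n +
1)` as `I ^ n * I` and put the last factor into the tensor. -/
theorem exists_tensorIncl_eq {n : ℕ} {x : A ⊗[K] V} (hx : x ∈ adicFil K V I (n + 1))
    (hP : x ∈ P.baseChange A) :
    ∃ y ∈ (I ^ n • ⊤ : Submodule A (I ⊗[K] P)), tensorIncl I P y = x := by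
  refine adicFil_baseChange_induction hx hP (fun a ha v hv => ?_) ?_
  · rw [pow_succ] at ha
    refine Submodule.mul_induction_on ha (fun b hb c hc => ?_) ?_
    · refine ⟨b • ((⟨c, hc⟩ : I) ⊗ₜ[K] (⟨v, hv⟩ : P)), Submodule.smul_mem_smul hb trivial, ?_⟩
      rw [map_smul, tensorIncl_tmul, TensorProduct.smul_tmul', smul_eq_mul]
    · rintro b c ⟨y, hy, h⟩ ⟨z, hz, h'⟩
      exact ⟨y + z, add_mem hy hz, by rw [map_add, h, h', TensorProduct.add_tmul]⟩
  · rintro b c ⟨y, hy, h⟩ ⟨z, hz, h'⟩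
    exact ⟨y + z, add_mem hy hz, by rw [map_add, h, h']⟩

theorem mem_smul_top_of_tensorIncl_mem {n : ℕ} {y : I ⊗[K] P}
    (hy : tensorIncl I P y ∈ adicFil K V I (n + 1)) :
    y ∈ (I ^ n • ⊤ : Submodule A (I ⊗[K] P)) := by
  obtain ⟨z, hz, h⟩ := exists_tensorIncl_eq hy (tensorIncl_mem_baseChange y)
  rwa [← tensorIncl_injective h]

namespace CompletedTensor

theorem reduce_eq {n : ℕ} {α : CompletedTensor K I P} {y : I ⊗[K] P}
    (hy : Submodule.Quotient.mk y = α.val n) :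
    reduce n α = adicRed K V I n (tensorIncl I P y) := by
  rw [← reduceAux_eq, reduce, LinearMap.comp_apply, AdicCompletion.eval_apply, ← hy]
  rfl

theorem exists_reduce_eq (n : ℕ) (α : CompletedTensor K I P) :
    ∃ x ∈ adicFil K V I 1, x ∈ P.baseChange A ∧ reduce n α = adicRed K V I n x := by
  obtain ⟨y, hy⟩ := Submodule.Quotient.mk_surjective _ (α.val n)
  exact ⟨_, tensorIncl_mem_adicFil_one y, tensorIncl_mem_baseChange y, reduce_eq hy⟩

theorem val_eq_of_le {m n : ℕ} (h : m ≤ n) {α : CompletedTensor K I P} {y : I ⊗[K] P}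
    (hy : Submodule.Quotient.mk y = α.val n) : Submodule.Quotient.mk y = α.val m := by
  have h' := α.property h
  change AdicCompletion.transitionMap I _ _ (α.val n) = α.val m at h'
  rw [← h', ← hy]
  rfl

theorem reduce_eq_of_le {m n : ℕ} (h : m ≤ n) {α : CompletedTensor K I P} {x : A ⊗[K] V}
    (hx : reduce n α = adicRed K V I n x) : reduce m α = adicRed K V I m x := by
  obtain ⟨y, hy⟩ := Submodule.Quotient.mk_surjective _ (α.val n)
  rw [reduce_eq hy, adicRed_eq_iff] at hx
  rw [reduce_eq (val_eq_of_le h hy), adicRed_eq_iff]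
  exact adicFil_anti h hx

/-- The reduction modulo `I ^ (n + 1)` determines the component of index `n` of the completion, by
the shift of filtrations between `I ⊗ P` and `A ⊗ V`. Over all `n` nothing is lost. -/
theorem ext_reduce {α α' : CompletedTensor K I P} (h : ∀ n, reduce n α = reduce n α') :
    α = α' := by
  refine AdicCompletion.ext fun n => ?_
  obtain ⟨y, hy⟩ := Submodule.Quotient.mk_surjective _ (α.val (n + 1))
  obtain ⟨y', hy'⟩ := Submodule.Quotient.mk_surjective _ (α'.val (n + 1))
  have h1 := h (n + 1)
  rw [reduce_eq hy, reduce_eq hy', adicRed_eq_iff, ← map_sub] at h1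
  rw [← val_eq_of_le n.le_succ hy, ← val_eq_of_le n.le_succ hy']
  exact (Submodule.Quotient.eq _).2 (mem_smul_top_of_tensorIncl_mem h1)

/-- Coherent sequences in `I ⊗ P` define elements of the completion. -/
theorem exists_of_coherent (x : ℕ → A ⊗[K] V) (h1 : ∀ n, x n ∈ adicFil K V I 1)
    (hP : ∀ n, x n ∈ P.baseChange A) (hx : ∀ n, x (n + 1) - x n ∈ adicFil K V I n) :
    ∃ α : CompletedTensor K I P, ∀ n, reduce n α = adicRed K V I n (x n) := by
  have hy : ∀ n, ∃ y : I ⊗[K] P, tensorIncl I P y = x n := fun n => by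
    obtain ⟨y, -, hy⟩ := exists_tensorIncl_eq (n := 0) (h1 n) (hP n)
    exact ⟨y, hy⟩
  choose y hy using hy
  -- The component of index `n` is taken from `y (n + 1)`: one order is lost on passing from `A ⊗ V`
  -- back to `I ⊗ P`.
  have hc : ∀ n, y (n + 2) - y (n + 1) ∈ (I ^ n • ⊤ : Submodule A (I ⊗[K] P)) := fun n => by
    refine mem_smul_top_of_tensorIncl_mem ?_
    rw [map_sub, hy, hy]
    exact hx (n + 1)
  have hc' : ∀ m n, m ≤ n → y (n + 1) - y (m + 1) ∈ (I ^ m • ⊤ : Submodule A (I ⊗[K] P)) := by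
    intro m n hmn
    induction n, hmn using Nat.le_induction with
    | base => simp
    | succ n hmn ih =>
      have h2 := add_mem (Submodule.smul_mono_left (Ideal.pow_le_pow_right hmn) (hc n)) ih
      rwa [sub_add_sub_cancel] at h2
  let α : CompletedTensor K I P := ⟨fun n => Submodule.Quotient.mk (y (n + 1)), fun {m n} hmn => by
    change Submodule.Quotient.mk (y (n + 1)) = Submodule.Quotient.mk (y (m + 1))
    exact (Submodule.Quotient.eq _).2 (hc' m n hmn)⟩
  refine ⟨α, fun n => ?_⟩
  have h2 : Submodule.Quotient.mk (y (n + 1)) = α.val n := rfl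
  refine (reduce_eq h2).trans ?_
  rw [adicRed_eq_iff, hy]
  exact hx n

/-- Common source of the formulas for base change and `d/dt`: a map of completions is computed by
any `Φ` on `A ⊗ V` that extends it and preserves the filtration. -/
theorem reduce_adicCompletionMap {Q : Submodule K V} (φ : I ⊗[K] P →+ J ⊗[K] Q)
    (hφ : ∀ (n : ℕ) (x : I ⊗[K] P), x ∈ (I ^ n • ⊤ : Submodule A (I ⊗[K] P)) →
      φ x ∈ (J ^ n • ⊤ : Submodule B (J ⊗[K] Q)))
    (Φ : A ⊗[K] V →ₗ[K] B ⊗[K] V) (hΦ : ∀ y, tensorIncl J Q (φ y) = Φ (tensorIncl I P y))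
    {n : ℕ} (hΦ' : ∀ x ∈ adicFil K V I n, Φ x ∈ adicFil K V J n)
    {α : CompletedTensor K I P} {x : A ⊗[K] V} (hx : reduce n α = adicRed K V I n x) :
    reduce n (adicCompletionMap φ hφ α : CompletedTensor K J Q) = adicRed K V J n (Φ x) := by
  obtain ⟨y, hy⟩ := Submodule.Quotient.mk_surjective _ (α.val n)
  have h1 : Submodule.Quotient.mk (φ y) = (adicCompletionMap φ hφ α).val n := by
    change _ = adicQuotientMap φ hφ n (α.val n)
    rw [← hy]
    rfl
  rw [reduce_eq hy, adicRed_eq_iff] at hx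
  rw [reduce_eq h1, adicRed_eq_iff, hΦ, ← map_sub]
  exact hΦ' _ hx

theorem reduce_map (ψ : A →ₐ[K] B) (h : I ≤ J.comap ψ) {n : ℕ} {α : CompletedTensor K I P}
    {x : A ⊗[K] V} (hx : reduce n α = adicRed K V I n x) :
    reduce n (map ψ h α) = adicRed K V J n (ψ.toLinearMap.rTensor V x) := by
  refine reduce_adicCompletionMap _ _ _ (fun y => ?_) (fun x hx => ?_) hx
  · change tensorIncl J P (idealTensorMap ψ h P y) = _
    induction y with
    | zero => simp
    | add x y hx hy => simp only [map_add, hx, hy]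
    | tmul a v => rfl
  · refine rTensor_mem_adicFil (fun a ha => ?_) hx
    have h1 : I ^ n ≤ (J ^ n).comap ψ := (Ideal.pow_right_mono h n).trans (Ideal.le_comap_pow ψ n)
    exact h1 ha

/-- `d/dt` on `A[t]`, as a linear map over the ground field. -/
def polyDeriv (K A : Type*) [Field K] [CommRing A] [Algebra K A] :
    Polynomial A →ₗ[K] Polynomial A :=
  Polynomial.derivative.restrictScalars K

theorem mem_polyIdeal_pow {n : ℕ} {p : Polynomial A} :
    p ∈ polyIdeal I ^ n ↔ ∀ i, p.coeff i ∈ I ^ n := by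
  rw [show polyIdeal I ^ n = polyIdeal (I ^ n) from (Ideal.map_pow _ _ _).symm,
    Ideal.mem_map_C_iff]

theorem polyDeriv_mem {n : ℕ} {p : Polynomial A} (hp : p ∈ polyIdeal I ^ n) :
    polyDeriv K A p ∈ polyIdeal I ^ n := by
  rw [show polyIdeal I ^ n = polyIdeal (I ^ n) from (Ideal.map_pow _ _ _).symm] at hp ⊢
  exact derivative_mem_polyIdeal hp

theorem reduce_deriv {n : ℕ} {α : CompletedTensor K (polyIdeal I) P} {x : Polynomial A ⊗[K] V}
    (hx : reduce n α = adicRed K V (polyIdeal I) n x) :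
    reduce n (deriv α) = adicRed K V (polyIdeal I) n ((polyDeriv K A).rTensor V x) := by
  refine reduce_adicCompletionMap _ _ _ (fun y => ?_) (fun x hx => ?_) hx
  · change tensorIncl _ P (derivativeTensor I P y) = _
    induction y with
    | zero => simp
    | add x y hx hy => simp only [map_add, hx, hy]
    | tmul a v => rfl
  · exact rTensor_mem_adicFil (fun a ha => polyDeriv_mem ha) hx

/-- Evaluation at `c` on `A[t]`. -/
def polyEval (K : Type*) {A : Type*} [Field K] [CommRing A] [Algebra K A] (c : A) :
    Polynomial A →ₐ[K] A := (Polynomial.aeval (R := A) c).restrictScalars K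

theorem polyEval_mem {n : ℕ} (c : A) {p : Polynomial A} (hp : p ∈ polyIdeal I ^ n) :
    polyEval K c p ∈ I ^ n := by
  rw [mem_polyIdeal_pow] at hp
  change Polynomial.aeval c p ∈ I ^ n
  rw [Polynomial.aeval_eq_sum_range]
  exact sum_mem fun i _ => (I ^ n).mul_mem_right _ (hp i)

theorem reduce_evalAt (c : A) {n : ℕ} {α : CompletedTensor K (polyIdeal I) P}
    {x : Polynomial A ⊗[K] V} (hx : reduce n α = adicRed K V (polyIdeal I) n x) :
    reduce n (evalAt c α) = adicRed K V I n ((polyEval K c).toLinearMap.rTensor V x) :=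
  reduce_map _ _ hx

/-- A form `μ` that restricts to `l` on `I` kills `I ^ 2`, so for `n ≥ 2` it takes the same value on
every representative modulo `I ^ n`. This makes contractions computable without passing to the
cotangent space. -/
theorem contractCotangent_eq {n : ℕ} (hn : 2 ≤ n) {α : CompletedTensor K I P} {x : A ⊗[K] V}
    (hx : reduce n α = adicRed K V I n x) (l : Module.Dual K I.Cotangent) (μ : A →ₗ[K] K)
    (hμ : ∀ a : I, μ a = l (I.toCotangent a)) :
    (contractCotangent (toCotangent α) l : V) = TensorProduct.lid K V (μ.rTensor V x) := by
  obtain ⟨y, hy⟩ := Submodule.Quotient.mk_surjective _ (α.val n)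
  have hy1 := val_eq_of_le (show 1 ≤ n by omega) hy
  rw [reduce_eq hy, adicRed_eq_iff] at hx
  have h0 : μ.rTensor V (tensorIncl I P y - x) = 0 := by
    refine rTensor_eq_zero_of_mem_adicFil (fun a ha => ?_) hx
    have ha2 : a ∈ I ^ 2 := Ideal.pow_le_pow_right hn ha
    have haI : a ∈ I := Ideal.pow_le_self two_ne_zero ha2
    rw [hμ ⟨a, haI⟩, (Ideal.toCotangent_eq_zero _ _).2 ha2, map_zero]
  rw [map_sub, sub_eq_zero] at h0
  rw [← h0]
  have hcot : toCotangent α =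
      TensorProduct.AlgebraTensorModule.map I.toCotangent (LinearMap.id : P →ₗ[K] P) y := by
    rw [CompletedTensor.toCotangent, LinearMap.comp_apply, AdicCompletion.eval_apply, ← hy1]
    rfl
  rw [hcot]
  clear hy hy1 hx h0 hcot
  induction y with
  | zero => simp [contractCotangent]
  | add x y hx hy =>
    simp only [map_add, ← hx, ← hy]
    simp [contractCotangent]
  | tmul a v =>
    change ((l (I.toCotangent a) • v : P) : V) = μ a • (v : V)
    rw [hμ, Submodule.coe_smul]

end CompletedTensor

/-- Linear forms on `I / I²` extend to linear forms on `A`. -/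
theorem exists_extension_dual_cotangent (I : Ideal A) (l : Module.Dual K I.Cotangent) :
    ∃ μ : A →ₗ[K] K, ∀ a : I, μ a = l (I.toCotangent a) := by
  obtain ⟨r, hr⟩ := LinearMap.exists_leftInverse_of_injective
    (Submodule.subtype (I.restrictScalars K)) (Submodule.ker_subtype _)
  refine ⟨l ∘ₗ (I.toCotangent.restrictScalars K) ∘ₗ r, fun a => ?_⟩
  have := LinearMap.congr_fun hr a
  exact congrArg (fun b => l (I.toCotangent b)) this

end CompletedTensorReps
end

noncomputable section

/-! ### Base change of multilinear maps: naturality, the Leibniz rule, gradings. -/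

section MultilinearBaseChange

variable {K : Type*} [Field K] {A B : Type*} [CommRing A] [Algebra K A] [CommRing B] [Algebra K B]
  {V W : Type*} [AddCommGroup V] [Module K V] [AddCommGroup W] [Module K W]

theorem multilinearBaseChange_cons_tmul {s : ℕ} (f : MultilinearMap K (fun _ : Fin (s + 1) => V) W)
    (a : A) (w : V) (v : Fin s → A ⊗[K] V) :
    multilinearBaseChange A (s + 1) f (Fin.cons (a ⊗ₜ w) v) =
      a • multilinearBaseChange A s (f.curryLeft w) v := by
  simp only [multilinearBaseChange, LinearMap.coe_mk, AddHom.coe_mk,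
    LinearMap.uncurryLeft_apply, Fin.cons_zero, LinearMap.liftBaseChange_tmul,
    LinearMap.comp_apply, smul_apply, Fin.tail_cons]

theorem multilinearBaseChange_one_tmul {s : ℕ} (f : MultilinearMap K (fun _ : Fin s => V) W)
    (v : Fin s → V) :
    multilinearBaseChange A s f (fun i => (1 : A) ⊗ₜ[K] v i) = 1 ⊗ₜ f v := by
  rw [multilinearBaseChange_tmul, Finset.prod_const_one]

theorem multilinear_cons_add {M N : Type*} [AddCommGroup M] [Module A M] [AddCommGroup N]
    [Module A N] {s : ℕ} (f : MultilinearMap A (fun _ : Fin (s + 1) => M) N) (x y : M)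
    (v : Fin s → M) : f (Fin.cons (x + y) v) = f (Fin.cons x v) + f (Fin.cons y v) :=
  f.cons_add v x y

theorem multilinear_cons_zero {M N : Type*} [AddCommGroup M] [Module A M] [AddCommGroup N]
    [Module A N] {s : ℕ} (f : MultilinearMap A (fun _ : Fin (s + 1) => M) N)
    (v : Fin s → M) : f (Fin.cons 0 v) = 0 :=
  f.map_coord_zero 0 rfl

theorem rTensor_multilinearBaseChange (φ : A →ₐ[K] B) {s : ℕ}
    (f : MultilinearMap K (fun _ : Fin s => V) W) (v : Fin s → A ⊗[K] V) :
    φ.toLinearMap.rTensor W (multilinearBaseChange A s f v) =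
      multilinearBaseChange B s f fun i => φ.toLinearMap.rTensor V (v i) := by
  induction s with
  | zero =>
    have h := multilinearBaseChange_one_tmul (A := A) f Fin.elim0
    have h' := multilinearBaseChange_one_tmul (A := B) f Fin.elim0
    rw [Subsingleton.elim v fun i => (1 : A) ⊗ₜ[K] Fin.elim0 i, h,
      Subsingleton.elim (fun i => φ.toLinearMap.rTensor V ((1 : A) ⊗ₜ[K] Fin.elim0 i))
        fun i => (1 : B) ⊗ₜ[K] Fin.elim0 i, h']
    simp
  | succ s ih =>
    obtain ⟨x, u, rfl⟩ : ∃ x u, v = Fin.cons x u := ⟨v 0, Fin.tail v, (Fin.cons_self_tail v).symm⟩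
    have hc : (fun i => φ.toLinearMap.rTensor V ((Fin.cons x u : Fin (s + 1) → A ⊗[K] V) i)) =
        Fin.cons (φ.toLinearMap.rTensor V x) fun i => φ.toLinearMap.rTensor V (u i) := by
      funext i
      refine Fin.cases rfl (fun i => rfl) i
    rw [hc]
    clear hc
    induction x with
    | zero => simp only [map_zero, multilinear_cons_zero]
    | add x y hx hy => simp only [map_add, multilinear_cons_add, hx, hy]
    | tmul a w =>
      rw [multilinearBaseChange_cons_tmul, LinearMap.rTensor_tmul, multilinearBaseChange_cons_tmul,
        ← ih]
      have hs : ∀ z : A ⊗[K] W, φ.toLinearMap.rTensor W (a • z) =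
          φ a • φ.toLinearMap.rTensor W z := fun z => by
        induction z with
        | zero => simp
        | add x y hx hy => simp only [smul_add, map_add, hx, hy]
        | tmul b w => simp [TensorProduct.smul_tmul']
      rw [hs]
      rfl

theorem rTensor_smul_of_derivation {D : A →ₗ[K] A} (hD : ∀ a b, D (a * b) = a * D b + D a * b)
    (a : A) (x : A ⊗[K] V) : D.rTensor V (a • x) = a • D.rTensor V x + D a • x := by
  induction x with
  | zero => simp
  | add x y hx hy => simp only [smul_add, map_add, hx, hy]; abel
  | tmul b v =>
    simp only [TensorProduct.smul_tmul', smul_eq_mul, LinearMap.rTensor_tmul, hD,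
      TensorProduct.add_tmul]

/-- The Leibniz rule for base changes of multilinear maps. -/
theorem rTensor_multilinearBaseChange_of_derivation {D : A →ₗ[K] A}
    (hD : ∀ a b, D (a * b) = a * D b + D a * b) {s : ℕ}
    (f : MultilinearMap K (fun _ : Fin s => V) W) (v : Fin s → A ⊗[K] V) :
    D.rTensor W (multilinearBaseChange A s f v) =
      ∑ k, multilinearBaseChange A s f (Function.update v k (D.rTensor V (v k))) := by
  induction s with
  | zero =>
    have h1 : D 1 = 0 := by simpa using hD 1 1
    have h := multilinearBaseChange_one_tmul (A := A) f Fin.elim0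
    rw [Subsingleton.elim v fun i => (1 : A) ⊗ₜ[K] Fin.elim0 i, h]
    simp [h1]
  | succ s ih =>
    obtain ⟨x, u, rfl⟩ : ∃ x u, v = Fin.cons x u := ⟨v 0, Fin.tail v, (Fin.cons_self_tail v).symm⟩
    rw [Fin.sum_univ_succ]
    simp only [Fin.cons_zero, Fin.cons_succ, Fin.update_cons_zero, ← Fin.cons_update]
    induction x with
    | zero => simp only [map_zero, multilinear_cons_zero, Finset.sum_const_zero, add_zero]
    | add x y hx hy =>
      simp only [map_add, multilinear_cons_add, hx, hy, Finset.sum_add_distrib]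
      abel
    | tmul a w =>
      simp only [multilinearBaseChange_cons_tmul, LinearMap.rTensor_tmul,
        rTensor_smul_of_derivation hD, ih, Finset.smul_sum]
      abel

/-- Membership is the vanishing of a multilinear map into the quotient by `Q.baseChange A`, so it
suffices to test entries `1 ⊗ v`. -/
theorem multilinearBaseChange_mem {s : ℕ} (f : MultilinearMap K (fun _ : Fin s => V) W)
    (P : Fin s → Submodule K V) (Q : Submodule K W)
    (hf : ∀ v : Fin s → V, (∀ i, v i ∈ P i) → f v ∈ Q) {v : Fin s → A ⊗[K] V}
    (hv : ∀ i, v i ∈ (P i).baseChange A) : multilinearBaseChange A s f v ∈ Q.baseChange A := by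
  have h := multilinear_eq_zero_of_span
    ((Q.baseChange A).mkQ.compMultilinearMap (multilinearBaseChange A s f))
    (fun i => (P i).map (TensorProduct.mk K A V 1)) (fun v hv => ?_) v
    (fun i => by rw [← Submodule.baseChange_eq_span]; exact hv i)
  · rwa [LinearMap.compMultilinearMap_apply, Submodule.mkQ_apply,
      Submodule.Quotient.mk_eq_zero] at h
  · choose u hu hu' using hv
    obtain rfl : (fun i => (1 : A) ⊗ₜ[K] u i) = v := funext hu'
    rw [LinearMap.compMultilinearMap_apply, Submodule.mkQ_apply, Submodule.Quotient.mk_eq_zero,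
      multilinearBaseChange_one_tmul]
    exact Submodule.tmul_mem_baseChange_of_mem _ (hf u hu)

end MultilinearBaseChange

/-! ### Brackets of elements of degrees zero and one. -/

namespace LInfinityAlgebra

variable {K : Type*} [Field K] {V : Type*} [AddCommGroup V] [Module K V]
  (g : LInfinityAlgebra K V) {A B : Type*} [CommRing A] [Algebra K A] [CommRing B] [Algebra K B]

theorem rTensor_bracketOver (φ : A →ₐ[K] B) (s : ℕ) (v : Fin s → A ⊗[K] V) :
    φ.toLinearMap.rTensor V (g.bracketOver A s v) =
      g.bracketOver B s fun i => φ.toLinearMap.rTensor V (v i) :=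
  rTensor_multilinearBaseChange φ _ v

theorem bracketOver_one_tmul (s : ℕ) (v : Fin s → V) :
    g.bracketOver A s (fun i => (1 : A) ⊗ₜ[K] v i) = 1 ⊗ₜ g.bracket s v :=
  multilinearBaseChange_one_tmul _ v

/-- Degree count: `0 + s + 2 - (s + 1) = 1`. Hence the gauge vector field is tangent to the space of
degree one elements. -/
theorem bracketOver_cons_mem_one {s : ℕ} {x : A ⊗[K] V} {v : Fin s → A ⊗[K] V}
    (hx : x ∈ (g.grading 0).baseChange A) (hv : ∀ i, v i ∈ (g.grading 1).baseChange A) :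
    g.bracketOver A (s + 1) (Fin.cons x v) ∈ (g.grading 1).baseChange A := by
  refine multilinearBaseChange_mem _
    (fun i => g.grading ((Fin.cons 0 fun _ => 1 : Fin (s + 1) → ℤ) i)) _ (fun v hv => ?_) ?_
  · have := g.bracket_mem (s + 1) (Fin.cons 0 fun _ => 1 : Fin (s + 1) → ℤ) v hv
    rw [Fin.sum_univ_succ] at this
    simp only [Fin.cons_zero, Fin.cons_succ, Finset.sum_const, Finset.card_univ, Fintype.card_fin,
      nsmul_eq_mul, mul_one, Nat.cast_add, Nat.cast_one] at this
    rwa [show (0 + (s : ℤ) + 2 - (s + 1)) = 1 by ring] at this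
  · exact Fin.cases hx hv

/-- Elements of degree one have reduced degree two, so the sign is `+1`; by multilinearity it is
enough to look at entries `1 ⊗ u`. -/
theorem bracketOver_swap {s : ℕ} {v : Fin s → A ⊗[K] V}
    (hv : ∀ i, v i ∈ (g.grading 1).baseChange A) (i j : Fin s) (hij : (j : ℕ) = i + 1) :
    g.bracketOver A s (v ∘ Equiv.swap i j) = g.bracketOver A s v := by
  have h := multilinear_eq_zero_of_span
    ((g.bracketOver A s).domDomCongr (Equiv.swap i j) - g.bracketOver A s)
    (fun i => (g.grading 1).map (TensorProduct.mk K A V 1)) (fun v hv => ?_) v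
    (fun i => by rw [← Submodule.baseChange_eq_span]; exact hv i)
  · rw [sub_apply, sub_eq_zero] at h
    exact h
  · choose u hu hu' using hv
    obtain rfl : (fun i => (1 : A) ⊗ₜ[K] u i) = v := funext hu'
    have h1 := g.bracket_swap s (fun _ => 1) u hu i j hij
    rw [Int.negOnePow_even _ (by decide), one_smul] at h1
    rw [sub_apply, sub_eq_zero, bracketOver_one_tmul, ← h1, ← bracketOver_one_tmul]
    rfl

/-- A degree one entry of a bracket of degree one elements can be moved to the first place. -/
theorem bracketOver_update_const {s : ℕ} {x y : A ⊗[K] V} (hx : x ∈ (g.grading 1).baseChange A)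
    (hy : y ∈ (g.grading 1).baseChange A) (k : Fin (s + 1)) :
    g.bracketOver A (s + 1) (Function.update (fun _ => x) k y) =
      g.bracketOver A (s + 1) (Fin.cons y fun _ => x) := by
  obtain ⟨k, hk⟩ := k
  induction k with
  | zero =>
    congr 1
    funext i
    refine Fin.cases ?_ (fun i => ?_) i
    · exact Function.update_self ..
    · exact Function.update_of_ne (Fin.succ_ne_zero i) ..
  | succ k ih =>
    rw [← ih (by omega), ← g.bracketOver_swap (v := Function.update (fun _ => x) ⟨k + 1, hk⟩ y) ?_
      ⟨k, by omega⟩ ⟨k + 1, hk⟩ rfl]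
    · congr 1
      funext i
      simp only [Function.comp_apply, Function.update_apply, Equiv.swap_apply_eq_iff,
        Equiv.swap_apply_right]
    · intro i
      rw [Function.update_apply]
      split_ifs
      exacts [hy, hx]

/-- The derivative of `{x, …, x}` for `x` of degree one. -/
theorem rTensor_bracketOver_const {D : A →ₗ[K] A} (hD : ∀ a b, D (a * b) = a * D b + D a * b)
    {x : A ⊗[K] V} (hx : x ∈ (g.grading 1).baseChange A) (s : ℕ) :
    D.rTensor V (g.bracketOver A (s + 1) fun _ => x) =
      (s + 1) • g.bracketOver A (s + 1) (Fin.cons (D.rTensor V x) fun _ => x) := by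
  have h := rTensor_multilinearBaseChange_of_derivation hD (g.bracket (s + 1)) fun _ => x
  refine h.trans ((Finset.sum_congr rfl fun k _ => g.bracketOver_update_const hx
    (rTensor_mem_baseChange hx) k).trans ?_)
  simp

end LInfinityAlgebra
end

noncomputable section

/-! ### Counting unshuffles by subsets. -/

section Unshuffle

/-- Sums over unshuffles of a function that only depends on the image of the first block are sums
over subsets. -/
theorem sum_unshuffle {N : Type*} [AddCommMonoid N] (s : ℕ) (j : Fin (s + 1))
    (F : Finset (Fin s) → N) :
    ∑ σ : {σ : Equiv.Perm (Fin s) //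
        (∀ a b : Fin s, a < b → (b : ℕ) < j → σ a < σ b) ∧
        (∀ a b : Fin s, a < b → (j : ℕ) ≤ a → σ a < σ b)},
      F ((Finset.univ.filter fun a : Fin s => (a : ℕ) < j).map σ.1.toEmbedding) =
    ∑ T ∈ Finset.powersetCard j Finset.univ, F T := by
  have hj : (j : ℕ) ≤ s := Nat.lt_succ_iff.1 j.2
  have hcard : (Finset.univ.filter fun a : Fin s => (a : ℕ) < j).card = j := by
    rw [Fin.card_filter_val_lt]; omega
  refine Finset.sum_bij (fun σ _ => (Finset.univ.filter fun a : Fin s => (a : ℕ) < j).map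
    σ.1.toEmbedding) (fun σ _ => ?_) (fun σ _ τ _ h => ?_) (fun T hT => ?_) (fun σ _ => rfl)
  · simp [Finset.mem_powersetCard, hcard]
  · have hmem : ∀ ρ : Equiv.Perm (Fin s), ∀ a : Fin s,
        ρ a ∈ (Finset.univ.filter fun a : Fin s => (a : ℕ) < j).map ρ.toEmbedding ↔ (a : ℕ) < j := by
      intro ρ a
      simp
    obtain ⟨T, hT⟩ : ∃ T, T = (Finset.univ.filter fun a : Fin s => (a : ℕ) < j).map
      σ.1.toEmbedding := ⟨_, rfl⟩
    have hTc : T.card = j := by rw [hT, Finset.card_map, hcard]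
    have hTc' : Tᶜ.card = s - j := by rw [Finset.card_compl, hTc, Fintype.card_fin]
    -- An unshuffle enumerates `T` increasingly on the first block and the complement of `T` on the
    -- second, so it is determined by `T`. Surjectivity below concatenates the same two
    -- enumerations.
    have h1 : ∀ ρ : {σ : Equiv.Perm (Fin s) //
        (∀ a b : Fin s, a < b → (b : ℕ) < j → σ a < σ b) ∧
        (∀ a b : Fin s, a < b → (j : ℕ) ≤ a → σ a < σ b)},
        T = (Finset.univ.filter fun a : Fin s => (a : ℕ) < j).map ρ.1.toEmbedding →
        (∀ i : Fin j, ρ.1 ⟨i, by omega⟩ = T.orderEmbOfFin hTc i) ∧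
        (∀ i : Fin (s - j), ρ.1 ⟨j + i, by omega⟩ = Tᶜ.orderEmbOfFin hTc' i) := by
      intro ρ hρ
      have hmemT : ∀ a : Fin s, ρ.1 a ∈ T ↔ (a : ℕ) < j := fun a => by rw [hρ]; exact hmem ρ.1 a
      constructor
      · refine congrFun (Finset.orderEmbOfFin_unique hTc (f := fun i : Fin j => ρ.1 ⟨i, by omega⟩)
          (fun i => ?_) (fun a b hab => ?_))
        · exact (hmemT _).2 i.2
        · exact ρ.2.1 _ _ hab b.2
      · refine congrFun (Finset.orderEmbOfFin_unique hTc'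
          (f := fun i : Fin (s - j) => ρ.1 ⟨j + i, by omega⟩) (fun i => ?_) (fun a b hab => ?_))
        · rw [Finset.mem_compl, hmemT]; simp
        · refine ρ.2.2 _ _ ?_ (by simp)
          have : (a : ℕ) < b := hab
          simp only [Fin.mk_lt_mk]; omega
    have h2 := h1 σ hT
    have h3 := h1 τ (hT.trans h)
    refine Subtype.ext (Equiv.ext fun a => ?_)
    by_cases ha : (a : ℕ) < j
    · exact (h2.1 ⟨a, ha⟩).trans (h3.1 ⟨a, ha⟩).symm
    · have h4 := (h2.2 ⟨a - j, by omega⟩).trans (h3.2 ⟨a - j, by omega⟩).symm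
      have h5 : (⟨j + (a - j : ℕ), by omega⟩ : Fin s) = a := Fin.ext (by simp; omega)
      simpa only [h5] using h4
  · have hTc : T.card = j := (Finset.mem_powersetCard.1 hT).2
    have hTc' : Tᶜ.card = s - j := by rw [Finset.card_compl, hTc, Fintype.card_fin]
    let e : Fin j ⊕ Fin (s - j) ≃ Fin s := finSumFinEquiv.trans (finCongr (by omega))
    let σ : Equiv.Perm (Fin s) := e.symm.trans (finSumEquivOfFinset hTc hTc')
    have he1 : ∀ a : Fin s, ∀ ha : (a : ℕ) < j, σ a = T.orderEmbOfFin hTc ⟨a, ha⟩ := by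
      intro a ha
      have : e.symm a = Sum.inl ⟨a, ha⟩ := by
        rw [Equiv.symm_apply_eq]; exact Fin.ext rfl
      simp only [σ, Equiv.trans_apply, this, finSumEquivOfFinset_inl]
    have he2 : ∀ a : Fin s, ∀ ha : (j : ℕ) ≤ a,
        σ a = Tᶜ.orderEmbOfFin hTc' ⟨a - j, by omega⟩ := by
      intro a ha
      have : e.symm a = Sum.inr ⟨a - j, by omega⟩ := by
        rw [Equiv.symm_apply_eq]
        refine Fin.ext ?_
        change (a : ℕ) = j + (a - j)
        omega
      simp only [σ, Equiv.trans_apply, this, finSumEquivOfFinset_inr]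
    refine ⟨⟨σ, fun a b hab hb => ?_, fun a b hab ha => ?_⟩, Finset.mem_univ _, ?_⟩
    · have hab' : (a : ℕ) < b := hab
      rw [he1 a (by omega), he1 b hb]
      exact (T.orderEmbOfFin hTc).strictMono hab
    · have hab' : (a : ℕ) < b := hab
      rw [he2 a ha, he2 b (by omega)]
      refine (Tᶜ.orderEmbOfFin hTc').strictMono ?_
      simp only [Fin.mk_lt_mk]; omega
    · refine Finset.eq_of_subset_of_card_le (fun x hx => ?_) (by rw [Finset.card_map, hcard, hTc])
      obtain ⟨a, ha, rfl⟩ := Finset.mem_map.1 hx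
      change σ a ∈ T
      rw [he1 a (Finset.mem_filter.1 ha).2]
      exact Finset.orderEmbOfFin_mem ..

/-- The subsets that avoid `0` are those of the other `m` indices. Slot `0` will hold `γ`, and a
term of the `L∞` relation depends only on the block that contains it. -/
theorem sum_powersetCard_ite_mem {N : Type*} [AddCommGroup N] (m j : ℕ) (X Y : N) :
    ∑ T ∈ Finset.powersetCard j (Finset.univ : Finset (Fin (m + 1))),
      (if (0 : Fin (m + 1)) ∈ T then X else Y) =
    ((m + 1).choose j - m.choose j) • X + m.choose j • Y := by
  have h1 : ((Finset.powersetCard j (Finset.univ : Finset (Fin (m + 1)))).filter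
      fun T => ¬ (0 : Fin (m + 1)) ∈ T) = Finset.powersetCard j (Finset.univ.erase 0) := by
    ext T
    simp only [Finset.mem_filter, Finset.mem_powersetCard, Finset.subset_univ, true_and,
      Finset.subset_erase]
    exact and_comm
  have h2 : ((Finset.powersetCard j (Finset.univ : Finset (Fin (m + 1)))).filter
      fun T => ¬ (0 : Fin (m + 1)) ∈ T).card = m.choose j := by
    rw [h1, Finset.card_powersetCard, Finset.card_erase_of_mem (Finset.mem_univ _),
      Finset.card_univ, Fintype.card_fin, Nat.add_sub_cancel]
  have h3 := Finset.card_filter_add_card_filter_not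
    (s := Finset.powersetCard j (Finset.univ : Finset (Fin (m + 1))))
    (fun T => (0 : Fin (m + 1)) ∈ T)
  rw [h2, Finset.card_powersetCard, Finset.card_univ, Fintype.card_fin] at h3
  rw [Finset.sum_ite, Finset.sum_const, Finset.sum_const, h2, ← h3, Nat.add_sub_cancel]

end Unshuffle

/-! ### The `L∞` relations for one element of degree zero and copies of one element of degree one.
-/

namespace LInfinityAlgebra

variable {K : Type*} [Field K] {V : Type*} [AddCommGroup V] [Module K V]
  (g : LInfinityAlgebra K V) {A : Type*} [CommRing A] [Algebra K A]

/-- The `L∞` relations for one element of degree zero and several elements of degree one: all the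
Koszul signs are trivial. -/
theorem relation_zero_one (s : ℕ) (v : Fin s → V)
    (hv : ∀ i : Fin s, v i ∈ g.grading (if (i : ℕ) = 0 then 0 else 1)) :
    ∑ j : Fin (s + 1),
      ∑ σ : {σ : Equiv.Perm (Fin s) //
          (∀ a b : Fin s, a < b → (b : ℕ) < j → σ a < σ b) ∧
          (∀ a b : Fin s, a < b → (j : ℕ) ≤ a → σ a < σ b)},
        g.bracket (s - j + 1)
          (Fin.cons
            (g.bracket j fun i : Fin j => v (σ.1 ⟨i, by omega⟩))
            (fun i : Fin (s - j) => v (σ.1 ⟨j + i, by omega⟩))) = 0 := by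
  rw [← g.relation s _ v hv]
  refine Finset.sum_congr rfl fun j _ => Finset.sum_congr rfl fun σ _ => ?_
  rw [Finset.prod_eq_one, one_smul]
  intro p _
  -- Of two distinct indices at most one is `0`; the other has degree one, hence even reduced
  -- degree, and the exponent is even.
  refine Int.negOnePow_even _ ?_
  have h : σ.1 p.1.1 ≠ σ.1 p.1.2 := fun h => p.2.1.ne (σ.1.injective h)
  have h' : (σ.1 p.1.1 : ℕ) ≠ (σ.1 p.1.2 : ℕ) := fun h'' => h (Fin.ext h'')
  split_ifs <;> first | omega | decide

/-- The left side, packaged as `Φ`, is `A`-multilinear in `v`, so the relation over `K` on entries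
`1 ⊗ u` implies it. -/
theorem relation_zero_one_over (s : ℕ) (v : Fin s → A ⊗[K] V)
    (hv : ∀ i : Fin s, v i ∈ (g.grading (if (i : ℕ) = 0 then 0 else 1)).baseChange A) :
    ∑ j : Fin (s + 1),
      ∑ σ : {σ : Equiv.Perm (Fin s) //
          (∀ a b : Fin s, a < b → (b : ℕ) < j → σ a < σ b) ∧
          (∀ a b : Fin s, a < b → (j : ℕ) ≤ a → σ a < σ b)},
        g.bracketOver A (s - j + 1)
          (Fin.cons
            (g.bracketOver A j fun i : Fin j => v (σ.1 ⟨i, by omega⟩))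
            (fun i : Fin (s - j) => v (σ.1 ⟨j + i, by omega⟩))) = 0 := by
  let e : ∀ j : Fin (s + 1), Fin j ⊕ Fin (s - j) ≃ Fin s := fun j =>
    finSumFinEquiv.trans (finCongr (by omega))
  let Φ : MultilinearMap A (fun _ : Fin s => A ⊗[K] V) (A ⊗[K] V) :=
    ∑ j : Fin (s + 1),
      ∑ σ : {σ : Equiv.Perm (Fin s) //
          (∀ a b : Fin s, a < b → (b : ℕ) < j → σ a < σ b) ∧
          (∀ a b : Fin s, a < b → (j : ℕ) ≤ a → σ a < σ b)},
        (((g.bracketOver A (s - j + 1)).curryLeft.compMultilinearMap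
          (g.bracketOver A j)).uncurrySum).domDomCongr ((e j).trans σ.1)
  have hΦ : ∀ u, Φ u = ∑ j : Fin (s + 1),
      ∑ σ : {σ : Equiv.Perm (Fin s) //
          (∀ a b : Fin s, a < b → (b : ℕ) < j → σ a < σ b) ∧
          (∀ a b : Fin s, a < b → (j : ℕ) ≤ a → σ a < σ b)},
        g.bracketOver A (s - j + 1)
          (Fin.cons
            (g.bracketOver A j fun i : Fin j => u (σ.1 ⟨i, by omega⟩))
            (fun i : Fin (s - j) => u (σ.1 ⟨j + i, by omega⟩))) := by
    intro u
    simp only [Φ, sum_apply]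
    rfl
  rw [← hΦ]
  refine multilinear_eq_zero_of_span Φ
    (fun i => (g.grading (if (i : ℕ) = 0 then 0 else 1)).map (TensorProduct.mk K A V 1))
    (fun v hv => ?_) v (fun i => by rw [← Submodule.baseChange_eq_span]; exact hv i)
  choose u hu hu' using hv
  obtain rfl : (fun i => (1 : A) ⊗ₜ[K] u i) = v := funext hu'
  have h := congrArg (TensorProduct.mk K A V 1) (g.relation_zero_one s u hu)
  rw [map_zero] at h
  rw [hΦ, ← h]
  simp only [map_sum, TensorProduct.mk_apply]
  refine Finset.sum_congr rfl fun j _ => Finset.sum_congr rfl fun σ _ => ?_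
  rw [← bracketOver_one_tmul, bracketOver_one_tmul]
  congr 1
  funext i
  refine Fin.cases rfl (fun i => rfl) i

/-- The family `(γ, x, …, x)`. -/
def headTail {M : Type*} (γ x : M) (s : ℕ) : Fin s → M := fun i => if (i : ℕ) = 0 then γ else x

theorem headTail_succ {M : Type*} (γ x : M) (s : ℕ) :
    headTail γ x (s + 1) = Fin.cons γ fun _ => x := by
  funext i
  refine Fin.cases rfl (fun i => rfl) i

/-- The `L∞` relation for `(γ, x, …, x)`, with multiplicities. -/
theorem relation_headTail (m : ℕ) {γ x : A ⊗[K] V} (hγ : γ ∈ (g.grading 0).baseChange A)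
    (hx : x ∈ (g.grading 1).baseChange A) :
    ∑ j ∈ Finset.range (m + 2),
      (((m + 1).choose j - m.choose j) • g.bracketOver A (m + 1 - j + 1)
          (Fin.cons (g.bracketOver A j (headTail γ x j)) fun _ => x) +
        m.choose j • g.bracketOver A (m + 1 - j + 1)
          (Fin.cons (g.bracketOver A j fun _ => x) (headTail γ x (m + 1 - j)))) = 0 := by
  have h := g.relation_zero_one_over (m + 1) (headTail γ x (m + 1)) (fun i => by
    unfold headTail
    split_ifs
    exacts [hγ, hx])
  rw [← h, ← Fin.sum_univ_eq_sum_range (fun j => ((m + 1).choose j - m.choose j) •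
    g.bracketOver A (m + 1 - j + 1) (Fin.cons (g.bracketOver A j (headTail γ x j)) fun _ => x) +
    m.choose j • g.bracketOver A (m + 1 - j + 1)
      (Fin.cons (g.bracketOver A j fun _ => x) (headTail γ x (m + 1 - j)))) (m + 2)]
  refine Finset.sum_congr rfl fun j _ => ?_
  rw [← sum_powersetCard_ite_mem, ← sum_unshuffle]
  refine Finset.sum_congr rfl fun σ _ => ?_
  have hne : ∀ a b : Fin (m + 1), (σ.1 a : ℕ) = 0 → (σ.1 b : ℕ) = 0 → a = b := fun a b h h' =>
    σ.1.injective (Fin.ext (h.trans h'.symm))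
  -- An unshuffle increases on each block and `γ` has the smallest index, so `γ` comes first in its
  -- block. All other entries are equal to `x`.
  split_ifs with h0
  · obtain ⟨a, ha, ha'⟩ := Finset.mem_map.1 h0
    have ha0 : (σ.1 a : ℕ) = 0 := congrArg Fin.val ha'
    have haj : (a : ℕ) < j := (Finset.mem_filter.1 ha).2
    have ha2 : (a : ℕ) = 0 := by
      by_contra hne0
      have := σ.2.1 0 a (Fin.pos_iff_ne_zero.2 fun h => hne0 (by rw [h]; rfl)) haj
      have : (σ.1 0 : ℕ) < σ.1 a := this
      omega
    have e1 : headTail γ x j = fun i : Fin j => headTail γ x (m + 1) (σ.1 ⟨i, by omega⟩) := by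
      funext i
      unfold headTail
      refine if_congr ⟨fun hi => ?_, fun hi => ?_⟩ rfl rfl
      · rw [← ha0]
        exact congrArg (fun b => (σ.1 b : ℕ)) (Fin.ext (hi.trans ha2.symm))
      · have := hne _ _ ha0 hi
        rw [this] at ha2
        exact ha2
    have e2 : (fun _ => x) = fun i : Fin (m + 1 - j) =>
        headTail γ x (m + 1) (σ.1 ⟨j + i, by omega⟩) := by
      funext i
      unfold headTail
      rw [if_neg fun hi => ?_]
      have := congrArg Fin.val (hne _ _ ha0 hi)
      simp only at this
      omega
    rw [e1, e2]
  · have h1 : ∀ b : Fin (m + 1), (b : ℕ) < j → (σ.1 b : ℕ) ≠ 0 := by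
      intro b hb hb0
      exact h0 (Finset.mem_map.2 ⟨b, by simpa using hb, Fin.ext hb0⟩)
    have e1 : (fun _ => x) = fun i : Fin j => headTail γ x (m + 1) (σ.1 ⟨i, by omega⟩) := by
      funext i
      unfold headTail
      rw [if_neg (h1 _ i.2)]
    have e2 : headTail γ x (m + 1 - j) = fun i : Fin (m + 1 - j) =>
        headTail γ x (m + 1) (σ.1 ⟨j + i, by omega⟩) := by
      obtain ⟨b, hb⟩ := σ.1.surjective 0
      have hb0 : (σ.1 b : ℕ) = 0 := by rw [hb]; rfl
      have hbj : (j : ℕ) ≤ b := by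
        by_contra hlt
        exact h1 b (by omega) hb0
      have hbj' : (b : ℕ) = j := by
        by_contra hne0
        have hlt : (⟨j, by omega⟩ : Fin (m + 1)) < b := by
          rw [Fin.lt_def]; simp only; omega
        have := σ.2.2 ⟨j, by omega⟩ b hlt le_rfl
        have : (σ.1 ⟨j, by omega⟩ : ℕ) < σ.1 b := this
        omega
      funext i
      unfold headTail
      refine if_congr ⟨fun hi => ?_, fun hi => ?_⟩ rfl rfl
      · rw [← hb0]
        exact congrArg (fun b => (σ.1 b : ℕ)) (Fin.ext (by simp only; omega))
      · have := congrArg Fin.val (hne _ _ hb0 hi)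
        simp only at this
        omega
    rw [e1, e2]

/-- The `L∞` relation for `(γ, x, …, x)`, in divided power form. -/
theorem relation_antidiagonal [CharZero K] (m : ℕ) {γ x : A ⊗[K] V}
    (hγ : γ ∈ (g.grading 0).baseChange A) (hx : x ∈ (g.grading 1).baseChange A) :
    ∑ p ∈ Finset.HasAntidiagonal.antidiagonal m, ((p.1.factorial : K)⁻¹ * (p.2.factorial : K)⁻¹) •
      (g.bracketOver A (p.2 + 1)
          (Fin.cons (g.bracketOver A (p.1 + 1) (Fin.cons γ fun _ => x)) fun _ => x) +
        g.bracketOver A (p.2 + 2)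
          (Fin.cons (g.bracketOver A p.1 fun _ => x) (Fin.cons γ fun _ => x))) = 0 := by
  have h := g.relation_headTail m hγ hx
  -- The first family has coefficient zero at `j = 0`, the second at `j = m + 1`. After shifting the
  -- first, Pascal's rule gives both the coefficient `m.choose i` for `0 ≤ i ≤ m`; dividing by `m!`
  -- gives the divided powers.
  rw [Finset.sum_add_distrib, Finset.sum_range_succ' , Finset.sum_range_succ
    (fun j => m.choose j • _)] at h
  simp only [Nat.choose_zero_right, tsub_self, zero_smul, add_zero, Nat.choose_succ_self,
    Nat.choose_succ_succ', Nat.add_sub_cancel] at h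
  rw [← Finset.sum_add_distrib] at h
  rw [Finset.Nat.sum_antidiagonal_eq_sum_range_succ_mk]
  have h2 := congrArg (fun z => (m.factorial : K)⁻¹ • z) h
  simp only [smul_zero, Finset.smul_sum] at h2
  rw [← h2]
  refine Finset.sum_congr rfl fun i hi => ?_
  have hi' : i ≤ m := Nat.lt_succ_iff.1 (Finset.mem_range.1 hi)
  rw [← smul_add, Nat.add_sub_add_right, show m + 1 - i = m - i + 1 by omega, headTail_succ, headTail_succ,
    ← Nat.cast_smul_eq_nsmul K, smul_smul]
  refine congrArg₂ (· • ·) ?_ rfl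
  have h3 : (m.factorial : K) = m.choose i * i.factorial * (m - i).factorial := by
    exact_mod_cast (Nat.choose_mul_factorial_mul_factorial hi').symm
  have h4 : (m.choose i : K) ≠ 0 := by exact_mod_cast (Nat.choose_pos hi').ne'
  have h5 : ∀ n : ℕ, (n.factorial : K) ≠ 0 := fun n => by exact_mod_cast n.factorial_ne_zero
  have := h5 i
  have := h5 (m - i)
  rw [h3]
  field_simp

end LInfinityAlgebra
end

noncomputable section

/-! ### Calculus on `A[t]` in characteristic zero. -/

section PolynomialIntegral

variable {K : Type*} [Field K] {A : Type*} [CommRing A] [Algebra K A]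

open CompletedTensor Polynomial

theorem polynomial_linearMap_ext {M : Type*} [AddCommGroup M] [Module K M]
    {f f' : Polynomial A →ₗ[K] M} (h : ∀ n a, f (monomial n a) = f' (monomial n a)) : f = f' := by
  refine LinearMap.ext fun p => ?_
  induction p using Polynomial.induction_on' with
  | add p q hp hq => rw [map_add, map_add, hp, hq]
  | monomial n a => exact h n a

/-- The integral `∫₀ᵗ` on `A[t]`. -/
def polyInt (K A : Type*) [Field K] [CommRing A] [Algebra K A] : Polynomial A →ₗ[K] Polynomial A :=
  Polynomial.lsum fun n => ((n + 1 : K)⁻¹) • (Polynomial.monomial (R := A) (n + 1)).restrictScalars K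

theorem polyInt_monomial (n : ℕ) (a : A) :
    polyInt K A (monomial n a) = (n + 1 : K)⁻¹ • monomial (n + 1) a := by
  rw [polyInt, Polynomial.lsum_apply, Polynomial.sum_monomial_index]
  · rfl
  · exact map_zero _

theorem polyInt_mem {I : Ideal A} {n : ℕ} {p : Polynomial A} (hp : p ∈ polyIdeal I ^ n) :
    polyInt K A p ∈ polyIdeal I ^ n := by
  rw [polyInt, Polynomial.lsum_apply]
  refine sum_mem fun i _ => ?_
  refine Submodule.smul_of_tower_mem (polyIdeal I ^ n) ((i + 1 : K)⁻¹)
    (x := monomial (i + 1) (p.coeff i)) ?_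
  rw [mem_polyIdeal_pow] at hp ⊢
  intro j
  rw [coeff_monomial]
  split_ifs
  exacts [hp i, zero_mem _]

theorem polyDeriv_comp_polyInt [CharZero K] : polyDeriv K A ∘ₗ polyInt K A = LinearMap.id := by
  refine polynomial_linearMap_ext fun n a => ?_
  change polyDeriv K A (polyInt K A (monomial n a)) = monomial n a
  have h : (n + 1 : K) ≠ 0 := by exact_mod_cast n.succ_ne_zero
  rw [polyInt_monomial, map_smul]
  change _ • derivative (monomial (n + 1) a) = _
  rw [derivative_monomial, Nat.add_sub_cancel, ← map_natCast (algebraMap K A), mul_comm,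
    ← Algebra.smul_def, ← smul_monomial, smul_smul, Nat.cast_add, Nat.cast_one, inv_mul_cancel₀ h,
    one_smul]

/-- The constant polynomials, as an algebra homomorphism. -/
def polyC (K A : Type*) [Field K] [CommRing A] [Algebra K A] : A →ₐ[K] Polynomial A :=
  (Polynomial.CAlgHom : A →ₐ[A] Polynomial A).restrictScalars K

theorem polyC_mem {I : Ideal A} {n : ℕ} {a : A} (ha : a ∈ I ^ n) :
    polyC K A a ∈ polyIdeal I ^ n := by
  rw [mem_polyIdeal_pow]
  intro j
  change (C a).coeff j ∈ _
  rw [coeff_C]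
  split_ifs
  exacts [ha, zero_mem _]

/-- The fundamental theorem of calculus, checked on monomials. As integration and constants preserve
the filtration, the order of `p` can be read off from those of `p'` and `p(0)`. -/
theorem polyInt_comp_polyDeriv [CharZero K] :
    polyInt K A ∘ₗ polyDeriv K A + (polyC K A).toLinearMap ∘ₗ (polyEval K (0 : A)).toLinearMap =
      LinearMap.id := by
  refine polynomial_linearMap_ext fun n a => ?_
  change polyInt K A (derivative (monomial n a)) + C (aeval (0 : A) (monomial n a)) = monomial n a
  rcases n with _ | n
  · simp
  · have h : (n + 1 : K) ≠ 0 := by exact_mod_cast n.succ_ne_zero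
    rw [derivative_monomial, Nat.add_sub_cancel, ← map_natCast (algebraMap K A), mul_comm,
      ← Algebra.smul_def, ← smul_monomial, map_smul, polyInt_monomial, smul_smul, Nat.cast_add,
      Nat.cast_one, mul_inv_cancel₀ h, one_smul]
    simp

theorem polyEval_zero_comp_polyInt :
    (polyEval K (0 : A)).toLinearMap ∘ₗ polyInt K A = 0 := by
  refine polynomial_linearMap_ext fun n a => ?_
  change polyEval K (0 : A) (polyInt K A (monomial n a)) = 0
  rw [polyInt_monomial, map_smul]
  change _ • aeval (0 : A) (monomial (n + 1) a) = 0
  simp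

theorem polyEval_comp_polyC (c : A) :
    (polyEval K c).toLinearMap ∘ₗ (polyC K A).toLinearMap = LinearMap.id := by
  refine LinearMap.ext fun a => ?_
  change aeval c (C a) = a
  simp

theorem polyDeriv_comp_polyC : polyDeriv K A ∘ₗ (polyC K A).toLinearMap = 0 := by
  refine LinearMap.ext fun a => ?_
  change derivative (C a) = 0
  simp

theorem polyDeriv_mul (p q : Polynomial A) :
    polyDeriv K A (p * q) = p * polyDeriv K A q + polyDeriv K A p * q := by
  change derivative (p * q) = _
  rw [derivative_mul, add_comm]
  rfl

end PolynomialIntegral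

theorem smul_sub_smul_mem {K A M : Type*} [Field K] [CommRing A] [Algebra K A] [AddCommGroup M]
    [Module A M] [Module K M] [IsScalarTower K A M] (S : Submodule A M) (c : K) {x y : M}
    (h : x - y ∈ S) : c • x - c • y ∈ S := by
  rw [← smul_sub]
  exact Submodule.smul_of_tower_mem _ _ h

/-- Exchanges a rectangular truncation of a double series for the triangle `i + j < N`: all terms
outside the triangle lie in `S`. The `L∞` relations hold diagonal by diagonal. -/
theorem sum_range_range_sub_mem {K M : Type*} [Ring K] [AddCommGroup M] [Module K M]
    (S : Submodule K M) {N P Q : ℕ} (hP : N ≤ P) (hQ : N ≤ Q) (f : ℕ → ℕ → M)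
    (hf : ∀ i j, N ≤ i + j → f i j ∈ S) :
    ∑ i ∈ Finset.range P, ∑ j ∈ Finset.range Q, f i j -
      ∑ m ∈ Finset.range N, ∑ p ∈ Finset.HasAntidiagonal.antidiagonal m, f p.1 p.2 ∈ S := by
  have h1 : ∑ m ∈ Finset.range N, ∑ p ∈ Finset.HasAntidiagonal.antidiagonal m, f p.1 p.2 =
      ∑ p ∈ (Finset.range P ×ˢ Finset.range Q).filter fun p : ℕ × ℕ => p.1 + p.2 < N, f p.1 p.2 := by
    rw [← Finset.sum_fiberwise_of_maps_to (t := Finset.range N) (g := fun p : ℕ × ℕ => p.1 + p.2)]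
    · refine Finset.sum_congr rfl fun m hm => Finset.sum_congr ?_ fun _ _ => rfl
      ext p
      simp only [Finset.mem_filter, Finset.mem_product, Finset.mem_range,
        Finset.HasAntidiagonal.mem_antidiagonal] at hm ⊢
      omega
    · intro p hp
      exact Finset.mem_range.2 (Finset.mem_filter.1 hp).2
  rw [h1, ← Finset.sum_product', ← Finset.sum_filter_add_sum_filter_not
    (Finset.range P ×ˢ Finset.range Q) (fun p : ℕ × ℕ => p.1 + p.2 < N) (fun p => f p.1 p.2),
    add_sub_cancel_left]
  exact sum_mem fun p hp => hf _ _ (not_lt.1 (Finset.mem_filter.1 hp).2)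

/-! ### The curvature and the gauge vector field. -/

namespace LInfinityAlgebra

variable {K : Type*} [Field K] {V : Type*} [AddCommGroup V] [Module K V]
  (g : LInfinityAlgebra K V) {A B : Type*} [CommRing A] [Algebra K A] [CommRing B] [Algebra K B]

theorem bracketOver_mem_adicFil {I : Ideal A} {s : ℕ} (e : Fin s → ℕ) {v : Fin s → A ⊗[K] V}
    (hv : ∀ i, v i ∈ adicFil K V I (e i)) : g.bracketOver A s v ∈ adicFil K V I (∑ i, e i) :=
  multilinear_mem_pow_smul _ e v hv

theorem bracketOver_const_mem_adicFil {I : Ideal A} (s : ℕ) {x : A ⊗[K] V}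
    (hx : x ∈ adicFil K V I 1) : (g.bracketOver A s fun _ => x) ∈ adicFil K V I s := by
  simpa using g.bracketOver_mem_adicFil (fun _ : Fin s => 1) (fun _ => hx)

theorem bracketOver_cons_mem_adicFil {I : Ideal A} {s n : ℕ} {x y : A ⊗[K] V}
    (hx : x ∈ adicFil K V I 1) (hy : y ∈ adicFil K V I n) :
    g.bracketOver A (s + 1) (Fin.cons y fun _ => x) ∈ adicFil K V I (n + s) := by
  have := g.bracketOver_mem_adicFil (I := I) (v := Fin.cons y fun _ => x)
    (Fin.cons n fun _ => 1 : Fin (s + 1) → ℕ) (Fin.cases hy fun _ => hx)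
  simpa [Fin.sum_univ_succ] using this

theorem bracketOver_cons_cons_mem_adicFil {I : Ideal A} {s n m : ℕ} {x y z : A ⊗[K] V}
    (hx : x ∈ adicFil K V I 1) (hy : y ∈ adicFil K V I n) (hz : z ∈ adicFil K V I m) :
    g.bracketOver A (s + 2) (Fin.cons y (Fin.cons z fun _ => x)) ∈
      adicFil K V I (n + (m + s)) := by
  have := g.bracketOver_mem_adicFil (I := I) (v := Fin.cons y (Fin.cons z fun _ => x))
    (Fin.cons n (Fin.cons m fun _ => 1) : Fin (s + 2) → ℕ)
    (Fin.cases hy (Fin.cases hz fun _ => hx))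
  simpa [Fin.sum_univ_succ] using this

theorem bracketOver_zero (v : Fin 0 → A ⊗[K] V) : g.bracketOver A 0 v = 0 := by
  rw [bracketOver, g.bracket_zero, map_zero]
  rfl

/-- The curvature `∑_{s ≤ M} {x, …, x} / s!`. -/
def mcSum (M : ℕ) (x : A ⊗[K] V) : A ⊗[K] V :=
  ∑ s ∈ Finset.range (M + 1), (s.factorial : K)⁻¹ • g.bracketOver A s fun _ => x

/-- The gauge vector field `∑_{i < M} {γ, x, …, x} / i!`. -/
def flowSum (M : ℕ) (γ x : A ⊗[K] V) : A ⊗[K] V :=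
  ∑ i ∈ Finset.range M, (i.factorial : K)⁻¹ • g.bracketOver A (i + 1) (Fin.cons γ fun _ => x)

theorem mcSum_eq_sum_Icc (M : ℕ) (x : A ⊗[K] V) :
    g.mcSum M x = ∑ s ∈ Finset.Icc 1 M, (s.factorial : K)⁻¹ • g.bracketOver A s fun _ => x := by
  rw [mcSum, Finset.range_eq_Ico, Finset.sum_eq_sum_Ico_succ_bot (by omega), bracketOver_zero,
    smul_zero, zero_add]
  rfl

theorem rTensor_mcSum (φ : A →ₐ[K] B) (M : ℕ) (x : A ⊗[K] V) :
    φ.toLinearMap.rTensor V (g.mcSum M x) = g.mcSum M (φ.toLinearMap.rTensor V x) := by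
  simp only [mcSum, map_sum, map_smul, rTensor_bracketOver]

theorem rTensor_flowSum (φ : A →ₐ[K] B) (M : ℕ) (γ x : A ⊗[K] V) :
    φ.toLinearMap.rTensor V (g.flowSum M γ x) =
      g.flowSum M (φ.toLinearMap.rTensor V γ) (φ.toLinearMap.rTensor V x) := by
  simp only [flowSum, map_sum, map_smul, rTensor_bracketOver]
  refine Finset.sum_congr rfl fun i _ => ?_
  congr 2
  funext j
  refine Fin.cases rfl (fun j => rfl) j

theorem flowSum_mem_one {M : ℕ} {γ x : A ⊗[K] V} (hγ : γ ∈ (g.grading 0).baseChange A)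
    (hx : x ∈ (g.grading 1).baseChange A) : g.flowSum M γ x ∈ (g.grading 1).baseChange A :=
  sum_mem fun _ _ => Submodule.smul_of_tower_mem _ _ (g.bracketOver_cons_mem_one hγ fun _ => hx)

variable {I : Ideal A}

theorem flowSum_sub_mem {M n : ℕ} (h : n ≤ M) {γ x : A ⊗[K] V} (hγ : γ ∈ adicFil K V I 1)
    (hx : x ∈ adicFil K V I 1) :
    g.flowSum M γ x - g.flowSum n γ x ∈ adicFil K V I (n + 1) := by
  rw [flowSum, flowSum, ← Finset.sum_range_add_sum_Ico _ h, add_sub_cancel_left]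
  refine sum_mem fun s hs => Submodule.smul_of_tower_mem _ _
    (adicFil_anti ?_ (g.bracketOver_cons_mem_adicFil hx hγ))
  have := (Finset.mem_Ico.1 hs).1
  omega

theorem flowSum_mem_adicFil {M n : ℕ} {γ x : A ⊗[K] V} (hγ : γ ∈ adicFil K V I n)
    (hx : x ∈ adicFil K V I 1) : g.flowSum M γ x ∈ adicFil K V I n :=
  sum_mem fun s _ => Submodule.smul_of_tower_mem _ _
    (adicFil_anti (by omega) (g.bracketOver_cons_mem_adicFil hx hγ))

/-- The linearisation of the curvature is the differential. -/
theorem mcSum_sub_sub_diff_mem {M n : ℕ} (hM : 1 ≤ M) (hn : 1 ≤ n) {y z : A ⊗[K] V}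
    (hz : z ∈ adicFil K V I 1) (hyz : y - z ∈ adicFil K V I n) :
    g.mcSum M y - g.mcSum M z - g.diff.lTensor A (y - z) ∈ adicFil K V I (n + 1) := by
  have hs : ∀ s, 2 ≤ s → (s.factorial : K)⁻¹ • (g.bracketOver A s fun _ => y) -
      (s.factorial : K)⁻¹ • (g.bracketOver A s fun _ => z) ∈ adicFil K V I (n + 1) := by
    intro s hs
    refine smul_sub_smul_mem _ _ ?_
    -- Each slot has order one, and `n - 1` is the excess of `y - z` over it. The result has order
    -- `s + n - 1`, which is at least `n + 1` because `s ≥ 2`.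
    have h := multilinear_sub_mem_pow_smul (I := I) (g.bracketOver A s) (fun _ => 1) (n - 1)
      (fun _ => y) (fun _ => z) (fun _ => hz) (fun _ => by
        rw [show 1 + (n - 1) = n by omega]; exact hyz)
    refine adicFil_anti ?_ h
    simp only [Finset.sum_const, Finset.card_univ, Fintype.card_fin, smul_eq_mul, mul_one]
    omega
  rw [mcSum_eq_sum_Icc, mcSum_eq_sum_Icc, ← Finset.sum_sub_distrib,
    ← Finset.Ioc_insert_left hM, Finset.sum_insert (by simp), Nat.factorial_one, Nat.cast_one,
    inv_one, one_smul, one_smul, bracketOver_one_eq, bracketOver_one_eq, ← map_sub,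
    add_sub_cancel_left]
  exact sum_mem fun s hs' => hs s (Finset.mem_Ioc.1 hs').1

/-- The linearisation of the gauge vector field is the differential of the generator. -/
theorem flowSum_sub_sub_diff_mem {M n : ℕ} (hM : 1 ≤ M) (hn : 1 ≤ n) {γ γ' x x' : A ⊗[K] V}
    (hγ : γ ∈ adicFil K V I 1) (hx : x ∈ adicFil K V I 1) (hγγ' : γ' - γ ∈ adicFil K V I n)
    (hxx' : x' - x ∈ adicFil K V I n) :
    g.flowSum M γ' x' - g.flowSum M γ x - g.diff.lTensor A (γ' - γ) ∈ adicFil K V I (n + 1) := by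
  obtain ⟨M, rfl⟩ : ∃ N, M = N + 1 := ⟨M - 1, by omega⟩
  have h0 : ∀ γ x : A ⊗[K] V, (((0 : ℕ).factorial : K)⁻¹ •
      g.bracketOver A (0 + 1) (Fin.cons γ fun _ => x)) = g.diff.lTensor A γ := by
    intro γ x
    rw [Nat.factorial_zero, Nat.cast_one, inv_one, one_smul, ← bracketOver_one_eq]
    congr 1
    funext i
    refine Fin.cases rfl (fun j => j.elim0) i
  rw [flowSum, flowSum, Finset.sum_range_succ', Finset.sum_range_succ', h0, h0, map_sub,
    add_sub_add_comm, add_sub_cancel_right, ← Finset.sum_sub_distrib]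
  refine sum_mem fun i _ => ?_
  refine smul_sub_smul_mem _ _ ?_
  have h := multilinear_sub_mem_pow_smul (I := I) (g.bracketOver A (i + 1 + 1)) (fun _ => 1) (n - 1)
    (Fin.cons γ' fun _ => x') (Fin.cons γ fun _ => x) (Fin.cases hγ fun _ => hx)
    (by
      rw [show 1 + (n - 1) = n by omega]
      exact Fin.cases hγγ' fun _ => hxx')
  refine adicFil_anti ?_ h
  simp only [Finset.sum_const, Finset.card_univ, Fintype.card_fin, smul_eq_mul, mul_one]
  omega

theorem multilinear_cons_sum {M N ι : Type*} [AddCommGroup M] [Module A M] [AddCommGroup N]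
    [Module A N] [Module K M] [IsScalarTower K A M] [Module K N]
    [IsScalarTower K A N] {s : ℕ} (f : MultilinearMap A (fun _ : Fin (s + 1) => M) N)
    (T : Finset ι) (c : ι → K) (x : ι → M) (v : Fin s → M) :
    f (Fin.cons (∑ i ∈ T, c i • x i) v) = ∑ i ∈ T, c i • f (Fin.cons (x i) v) := by
  have h : ∀ y : M, f (Fin.cons y v) = (f.curryLeft y) v := fun y => rfl
  classical
  induction T using Finset.induction_on with
  | empty => simp [multilinear_cons_zero]
  | insert i T hi ih =>
    rw [Finset.sum_insert hi, Finset.sum_insert hi, multilinear_cons_add, ih,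
      ← algebraMap_smul A (c i) (x i), f.cons_smul, algebraMap_smul]

/-- Along a solution of the gauge flow, the derivative of the curvature `F` is
`-∑ {F, γ, x, …, x} / l!`. -/
theorem rTensor_mcSum_add_mem [CharZero K] {D : A →ₗ[K] A}
    (hD : ∀ a b, D (a * b) = a * D b + D a * b) {N : ℕ} {γ x : A ⊗[K] V}
    (hγ : γ ∈ adicFil K V I 1) (hγ0 : γ ∈ (g.grading 0).baseChange A)
    (hx : x ∈ adicFil K V I 1) (hx1 : x ∈ (g.grading 1).baseChange A)
    (hflow : D.rTensor V x - g.flowSum N γ x ∈ adicFil K V I N) :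
    D.rTensor V (g.mcSum N x) + ∑ l ∈ Finset.range N, (l.factorial : K)⁻¹ •
      g.bracketOver A (l + 2) (Fin.cons (g.mcSum N x) (Fin.cons γ fun _ => x)) ∈
        adicFil K V I N := by
  let S : Submodule K (A ⊗[K] V) := (adicFil K V I N).restrictScalars K
  let T1 : ℕ → ℕ → A ⊗[K] V := fun i l => ((i.factorial : K)⁻¹ * (l.factorial : K)⁻¹) •
    g.bracketOver A (l + 1) (Fin.cons (g.bracketOver A (i + 1) (Fin.cons γ fun _ => x)) fun _ => x)
  let T2 : ℕ → ℕ → A ⊗[K] V := fun i l => ((i.factorial : K)⁻¹ * (l.factorial : K)⁻¹) •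
    g.bracketOver A (l + 2) (Fin.cons (g.bracketOver A i fun _ => x) (Fin.cons γ fun _ => x))
  have h1 : D.rTensor V (g.mcSum N x) = ∑ l ∈ Finset.range N, (l.factorial : K)⁻¹ •
      g.bracketOver A (l + 1) (Fin.cons (D.rTensor V x) fun _ => x) := by
    rw [mcSum, Finset.sum_range_succ', bracketOver_zero, smul_zero, add_zero, map_sum]
    refine Finset.sum_congr rfl fun l _ => ?_
    rw [map_smul, g.rTensor_bracketOver_const hD hx1, ← Nat.cast_smul_eq_nsmul K (l + 1), smul_smul]
    congr 1
    have h3 : (l.factorial : K) ≠ 0 := by exact_mod_cast l.factorial_ne_zero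
    have h4 : ((l + 1 : ℕ) : K) ≠ 0 := by exact_mod_cast l.succ_ne_zero
    rw [Nat.factorial_succ, Nat.cast_mul, mul_inv, mul_right_comm, inv_mul_cancel₀ h4, one_mul]
  -- Replace `D x` by the flow field inside each bracket; the error has order `N`. Expanding the
  -- flow field gives the double sum of `T1`.
  have h2 : D.rTensor V (g.mcSum N x) -
      ∑ i ∈ Finset.range N, ∑ l ∈ Finset.range N, T1 i l ∈ S := by
    rw [h1, Finset.sum_comm, ← Finset.sum_sub_distrib]
    refine sum_mem fun l _ => ?_
    have h3 : ∑ i ∈ Finset.range N, T1 i l = (l.factorial : K)⁻¹ •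
        g.bracketOver A (l + 1) (Fin.cons (g.flowSum N γ x) fun _ => x) := by
      rw [flowSum, multilinear_cons_sum, Finset.smul_sum]
      refine Finset.sum_congr rfl fun i _ => ?_
      rw [smul_smul, mul_comm]
    rw [h3]
    refine smul_sub_smul_mem (adicFil K V I N) _ ?_
    have h4 : g.bracketOver A (l + 1) (Fin.cons (D.rTensor V x) fun _ => x) -
        g.bracketOver A (l + 1) (Fin.cons (g.flowSum N γ x) fun _ => x) =
        g.bracketOver A (l + 1) (Fin.cons (D.rTensor V x - g.flowSum N γ x) fun _ => x) := by
      rw [sub_eq_iff_eq_add, ← multilinear_cons_add, sub_add_cancel]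
    rw [h4]
    exact adicFil_anti (by omega) (g.bracketOver_cons_mem_adicFil hx hflow)
  have h3 : ∑ l ∈ Finset.range N, (l.factorial : K)⁻¹ •
      g.bracketOver A (l + 2) (Fin.cons (g.mcSum N x) (Fin.cons γ fun _ => x)) =
      ∑ i ∈ Finset.range (N + 1), ∑ l ∈ Finset.range N, T2 i l := by
    rw [Finset.sum_comm]
    refine Finset.sum_congr rfl fun l _ => ?_
    rw [mcSum, multilinear_cons_sum, Finset.smul_sum]
    refine Finset.sum_congr rfl fun i _ => ?_
    rw [smul_smul, mul_comm]
  have h4 := sum_range_range_sub_mem (N := N) S le_rfl le_rfl T1 (fun i l hil => S.smul_mem _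
    (adicFil_anti (show N ≤ 1 + i + l by omega)
      (g.bracketOver_cons_mem_adicFil hx (g.bracketOver_cons_mem_adicFil hx hγ))))
  have h5 := sum_range_range_sub_mem (N := N) S N.le_succ le_rfl T2 (fun i l hil => S.smul_mem _
    (adicFil_anti (show N ≤ i + (1 + l) by omega)
      (g.bracketOver_cons_cons_mem_adicFil hx (g.bracketOver_const_mem_adicFil i hx) hγ)))
  -- On the diagonal `i + l = m` the terms of both kinds involve one `γ` and `m` copies of `x`, and
  -- they cancel by the `L∞` relation for that tuple.
  have h6 : ∑ m ∈ Finset.range N, ∑ p ∈ Finset.HasAntidiagonal.antidiagonal m, T1 p.1 p.2 +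
      ∑ m ∈ Finset.range N, ∑ p ∈ Finset.HasAntidiagonal.antidiagonal m, T2 p.1 p.2 = 0 := by
    rw [← Finset.sum_add_distrib]
    refine Finset.sum_eq_zero fun m _ => ?_
    rw [← Finset.sum_add_distrib, ← g.relation_antidiagonal m hγ0 hx1]
    refine Finset.sum_congr rfl fun p _ => ?_
    rw [smul_add]
  rw [h3]
  have h7 : ∀ a b c d e : A ⊗[K] V, d + e = 0 → a + c = (a - b) + ((b - d) + (c - e)) :=
    fun a b c d e h => by rw [eq_neg_of_add_eq_zero_left h]; abel
  rw [h7 _ _ _ _ _ h6]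
  exact S.add_mem h2 (S.add_mem h4 h5)

open CompletedTensor in
/-- The gauge flow preserves the Maurer--Cartan equation. -/
theorem mcSum_mem_of_flow [CharZero K] {N : ℕ} {γ x : Polynomial A ⊗[K] V}
    (hγ : γ ∈ adicFil K V (polyIdeal I) 1) (hγ0 : γ ∈ (g.grading 0).baseChange (Polynomial A))
    (hx : x ∈ adicFil K V (polyIdeal I) 1) (hx1 : x ∈ (g.grading 1).baseChange (Polynomial A))
    (hflow : (polyDeriv K A).rTensor V x - g.flowSum N γ x ∈ adicFil K V (polyIdeal I) N)
    (h0 : g.mcSum N ((polyEval K (0 : A)).toLinearMap.rTensor V x) ∈ adicFil K V I N) :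
    g.mcSum N x ∈ adicFil K V (polyIdeal I) N := by
  have h := g.rTensor_mcSum_add_mem (D := polyDeriv K A) polyDeriv_mul hγ hγ0 hx hx1 hflow
  -- Bootstrapping: if `F` has order `k`, each `{F, γ, x, …, x}` has order `k + 1` as `γ` has order
  -- one, so `F'` has order `k + 1`. With `F(0)` of order `N`, integration gives `F` order `k + 1`.
  have key : ∀ k ≤ N, g.mcSum N x ∈ adicFil K V (polyIdeal I) k := by
    intro k
    induction k with
    | zero => intro _; rw [adicFil_zero]; trivial
    | succ k ih =>
      intro hk
      have h1 : (polyDeriv K A).rTensor V (g.mcSum N x) ∈ adicFil K V (polyIdeal I) (k + 1) := by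
        refine (Submodule.add_mem_iff_left _ (sum_mem fun l _ => ?_)).1 (adicFil_anti hk h)
        exact Submodule.smul_of_tower_mem _ _ (adicFil_anti (by omega)
          (g.bracketOver_cons_cons_mem_adicFil hx (ih (by omega)) hγ))
      have h2 := LinearMap.congr_fun (congrArg (LinearMap.rTensor V)
        (polyInt_comp_polyDeriv (K := K) (A := A))) (g.mcSum N x)
      rw [LinearMap.rTensor_add, LinearMap.rTensor_comp, LinearMap.rTensor_comp,
        LinearMap.rTensor_id, LinearMap.id_apply, LinearMap.add_apply, LinearMap.comp_apply,
        LinearMap.comp_apply, rTensor_mcSum] at h2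
      rw [← h2]
      exact add_mem (rTensor_mem_adicFil (fun a ha => polyInt_mem ha) h1)
        (rTensor_mem_adicFil (fun a ha => polyC_mem (K := K) ha) (adicFil_anti hk h0))
  exact key N le_rfl

end LInfinityAlgebra
end

noncomputable section

/-! ### Power series algebras: cotangent space, homomorphisms and their first variation. -/

section PowerSeries

open MvPowerSeries

variable {K : Type*} [Field K] {k : ℕ}

theorem MvPowerSeries.coeff_single_X_mul (i j : Fin k) (f : MvPowerSeries (Fin k) K) :
    coeff (Finsupp.single i 1) (X j * f) = if i = j then constantCoeff f else 0 := by
  classical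
  rw [X, coeff_monomial_mul, one_mul]
  have h : (Finsupp.single j 1 ≤ Finsupp.single i 1) ↔ i = j := by
    rw [Finsupp.single_le_iff]
    by_cases hij : i = j
    · simp [hij]
    · simp [hij]
  simp only [h]
  split_ifs with hij
  · subst hij
    simp
  · rfl

/-- A power series is the sum of its constant term and a combination of the variables. -/
theorem MvPowerSeries.exists_eq_C_add_sum_X_mul (f : MvPowerSeries (Fin k) K) :
    ∃ c : Fin k → MvPowerSeries (Fin k) K, f = C (constantCoeff f) + ∑ i, X i * c i ∧
      ∀ i, constantCoeff (c i) = coeff (Finsupp.single i 1) f := by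
  classical
  -- `F i` collects the monomials whose first variable with nonzero exponent is `X i`, so that each
  -- nonconstant monomial is counted exactly once.
  let F : Fin k → MvPowerSeries (Fin k) K := fun i n =>
    if n i ≠ 0 ∧ ∀ j < i, n j = 0 then coeff n f else 0
  have hF : ∀ i n, coeff n (F i) = if n i ≠ 0 ∧ ∀ j < i, n j = 0 then coeff n f else 0 :=
    fun _ _ => rfl
  have hdvd : ∀ i, X i ∣ F i := fun i => by
    rw [X_dvd_iff]
    intro m hm
    rw [hF, if_neg (fun h => h.1 hm)]
  choose c hc using hdvd
  have hf : f = C (constantCoeff f) + ∑ i, X i * c i := by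
    simp only [← hc]
    ext n
    rw [map_add, map_sum, coeff_C]
    simp only [hF]
    by_cases hn : n = 0
    · simp [hn]
    · rw [if_neg hn, zero_add]
      have hex : (Finset.univ.filter fun i => n i ≠ 0).Nonempty := by
        by_contra h
        rw [Finset.not_nonempty_iff_eq_empty, Finset.filter_eq_empty_iff] at h
        exact hn (Finsupp.ext fun i => by simpa using h (Finset.mem_univ i))
      set i₀ := (Finset.univ.filter fun i => n i ≠ 0).min' hex with hi₀
      have h1 : n i₀ ≠ 0 := (Finset.mem_filter.1 (Finset.min'_mem _ hex)).2
      have h2 : ∀ j, n j ≠ 0 → i₀ ≤ j := fun j hj => Finset.min'_le _ _ (by simpa using hj)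
      rw [Finset.sum_eq_single i₀]
      · rw [if_pos ⟨h1, fun j hj => by_contra fun h => absurd (h2 j h) (not_le.2 hj)⟩]
      · intro i _ hi
        refine if_neg fun h => ?_
        rcases lt_or_gt_of_ne hi with h' | h'
        · exact absurd (h2 i h.1) (not_le.2 h')
        · exact h1 (h.2 _ h')
      · simp
  refine ⟨c, hf, fun i => ?_⟩
  have h := congrArg (coeff (Finsupp.single i 1)) hf
  rw [h, map_add, map_sum, coeff_C, if_neg (by simp)]
  simp [coeff_single_X_mul]

theorem MvPowerSeries.mem_maximalIdeal_iff {f : MvPowerSeries (Fin k) K} :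
    f ∈ IsLocalRing.maximalIdeal (MvPowerSeries (Fin k) K) ↔ constantCoeff f = 0 := by
  rw [IsLocalRing.mem_maximalIdeal, mem_nonunits_iff, isUnit_iff_constantCoeff, isUnit_iff_ne_zero,
    not_not]

theorem MvPowerSeries.sub_sum_smul_X_mem {f : MvPowerSeries (Fin k) K}
    (hf : f ∈ IsLocalRing.maximalIdeal (MvPowerSeries (Fin k) K)) :
    f - ∑ i, coeff (Finsupp.single i 1) f • X i ∈
      IsLocalRing.maximalIdeal (MvPowerSeries (Fin k) K) ^ 2 := by
  obtain ⟨c, hc, hc'⟩ := exists_eq_C_add_sum_X_mul f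
  rw [mem_maximalIdeal_iff.1 hf, map_zero, zero_add] at hc
  have : f - ∑ i, coeff (Finsupp.single i 1) f • X i =
      ∑ i, X i * (c i - C (constantCoeff (c i))) := by
    nth_rw 1 [hc]
    rw [← Finset.sum_sub_distrib]
    refine Finset.sum_congr rfl fun i _ => ?_
    rw [← hc', mul_sub, smul_eq_C_mul, mul_comm (C _)]
  rw [this, pow_two]
  refine sum_mem fun i _ => Ideal.mul_mem_mul ?_ ?_
  · rw [mem_maximalIdeal_iff]; simp
  · rw [mem_maximalIdeal_iff]; simp

/-- The coordinates on the cotangent space of a power series algebra. -/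
theorem MvPowerSeries.exists_cotangent_coordinate (i : Fin k) :
    ∃ l : Module.Dual K (IsLocalRing.maximalIdeal (MvPowerSeries (Fin k) K)).Cotangent,
      ∀ f : IsLocalRing.maximalIdeal (MvPowerSeries (Fin k) K),
        l ((IsLocalRing.maximalIdeal (MvPowerSeries (Fin k) K)).toCotangent f) =
          coeff (Finsupp.single i 1) (f : MvPowerSeries (Fin k) K) := by
  refine ⟨Ideal.Cotangent.lift ((coeff (R := K) (Finsupp.single i 1)) ∘ₗ
    (Submodule.subtype _).restrictScalars K) (fun f g => ?_), fun f => rfl⟩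
  change coeff (Finsupp.single i 1) ((f : MvPowerSeries (Fin k) K) * (g : MvPowerSeries (Fin k) K)) = 0
  obtain ⟨c, hc, -⟩ := exists_eq_C_add_sum_X_mul (f : MvPowerSeries (Fin k) K)
  have hf := mem_maximalIdeal_iff.1 f.2
  have hg := mem_maximalIdeal_iff.1 g.2
  rw [hc, hf, map_zero, zero_add, Finset.sum_mul, map_sum]
  refine Finset.sum_eq_zero fun j _ => ?_
  rw [mul_assoc, coeff_single_X_mul, map_mul, hg, mul_zero, ite_self]

variable {R : Type*} [CommRing R] [Algebra K R]

/-- Power series can be evaluated at elements of an ideal for which the ring is complete. -/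
theorem MvPowerSeries.exists_algHom_X (I : Ideal R) [IsAdicComplete I R] (x : Fin k → R)
    (hx : ∀ i, x i ∈ I) : ∃ ψ : MvPowerSeries (Fin k) K →ₐ[K] R, ∀ i, ψ (X i) = x i := by
  have hle : ∀ n, MvPolynomial.idealOfVars (Fin k) K ^ n ≤
      (I ^ n).comap (MvPolynomial.aeval x : MvPolynomial (Fin k) K →ₐ[K] R) := fun n => by
    refine (Ideal.pow_right_mono ?_ n).trans (Ideal.le_comap_pow _ n)
    rw [MvPolynomial.idealOfVars, Ideal.span_le]
    rintro _ ⟨i, rfl⟩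
    simpa using hx i
  -- Truncate in total degree, then evaluate: the discarded terms land in `I ^ n`. These maps are
  -- compatible and glue by completeness of `R`.
  let f : (n : ℕ) → MvPowerSeries (Fin k) K →ₐ[K] R ⧸ I ^ n := fun n =>
    (Ideal.quotientMapₐ (I ^ n) (MvPolynomial.aeval x) (hle n)).comp
      ((truncTotalAlgHom (Fin k) K n).restrictScalars K)
  have hfm : ∀ n p, f n p = Ideal.Quotient.mk (I ^ n) (MvPolynomial.aeval x (truncTotal n p)) :=
    fun n p => rfl
  have hfp : ∀ n (p : MvPolynomial (Fin k) K), f n p =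
      Ideal.Quotient.mk (I ^ n) (MvPolynomial.aeval x p) := fun n p => by
    rw [hfm, Ideal.Quotient.eq, ← map_sub]
    refine hle n ((MvPolynomial.mem_pow_idealOfVars_iff' n _).2 fun d hd => ?_)
    rw [MvPolynomial.coeff_sub, coeff_truncTotal _ hd, MvPolynomial.coeff_coe, sub_self]
  have hc : ∀ {m n : ℕ} (h : m ≤ n),
      (Ideal.Quotient.factorₐ K (Ideal.pow_le_pow_right h)).comp (f n) = f m := by
    intro m n h
    refine AlgHom.ext fun p => ?_
    rw [AlgHom.comp_apply, hfm, hfm]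
    change Ideal.Quotient.mk (I ^ m) _ = _
    rw [Ideal.Quotient.eq, ← map_sub]
    exact hle m (truncTotal_sub_truncTotal_mem_pow_idealOfVars h le_rfl p)
  refine ⟨IsAdicComplete.liftAlgHom I f hc, fun i => ?_⟩
  refine (IsHausdorff.eq_iff_smodEq (I := I)).2 fun n => ?_
  rw [SModEq.sub_mem, smul_eq_mul, Ideal.mul_top, ← Ideal.Quotient.eq,
    IsAdicComplete.mk_liftAlgHom]
  have := hfp n (MvPolynomial.X i)
  rwa [MvPolynomial.coe_X, MvPolynomial.aeval_X] at this

variable {I : Ideal R} {ψ ψ' : MvPowerSeries (Fin k) K →ₐ[K] R}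

theorem MvPowerSeries.maximalIdeal_le_comap (h : ∀ i, ψ (X i) ∈ I) :
    IsLocalRing.maximalIdeal (MvPowerSeries (Fin k) K) ≤ I.comap ψ := by
  intro f hf
  obtain ⟨c, hc, -⟩ := exists_eq_C_add_sum_X_mul f
  rw [Ideal.mem_comap, hc, mem_maximalIdeal_iff.1 hf, map_zero, zero_add, map_sum]
  refine sum_mem fun i _ => ?_
  rw [map_mul]
  exact I.mul_mem_right _ (h i)

theorem MvPowerSeries.algHom_C (ψ : MvPowerSeries (Fin k) K →ₐ[K] R) (a : K) :
    ψ (C a) = algebraMap K R a := ψ.commutes a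

/-- No continuity is assumed. Writing `f = C + ∑ X i * c i` expresses the difference on `f` through
the differences on the `c i`, multiplied by `ψ (X i) ∈ I`; this gains one order per induction step,
up to the order `n` on the variables. -/
theorem MvPowerSeries.algHom_sub_mem {n : ℕ} (h : ∀ i, ψ (X i) ∈ I)
    (hn : ∀ i, ψ' (X i) - ψ (X i) ∈ I ^ n) (f : MvPowerSeries (Fin k) K) :
    ψ' f - ψ f ∈ I ^ n := by
  have key : ∀ m ≤ n, ∀ f, ψ' f - ψ f ∈ I ^ m := by
    intro m
    induction m with
    | zero => intro _ f; simp
    | succ m ih =>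
      intro hm f
      obtain ⟨c, hc, -⟩ := exists_eq_C_add_sum_X_mul f
      have : ψ' f - ψ f = ∑ i, ((ψ' (X i) - ψ (X i)) * ψ' (c i) +
          ψ (X i) * (ψ' (c i) - ψ (c i))) := by
        rw [hc]
        simp only [map_add, map_sum, map_mul, algHom_C]
        rw [add_sub_add_left_eq_sub, ← Finset.sum_sub_distrib]
        exact Finset.sum_congr rfl fun i _ => by ring
      rw [this]
      refine sum_mem fun i _ => add_mem ?_ ?_
      · exact Ideal.mul_mem_right _ _ (Ideal.pow_le_pow_right hm (hn i))
      · rw [pow_succ']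
        exact Ideal.mul_mem_mul (h i) (ih (by omega) _)
  exact key n le_rfl f

/-- Taylor's formula to first order. Once the constant terms of the `c i` are removed, each
remaining product has a factor in `I ^ n` and another in `I`. -/
theorem MvPowerSeries.algHom_sub_sub_sum_mem {n : ℕ} (h : ∀ i, ψ (X i) ∈ I)
    (h' : ∀ i, ψ' (X i) ∈ I) (hn : ∀ i, ψ' (X i) - ψ (X i) ∈ I ^ n)
    (f : MvPowerSeries (Fin k) K) :
    ψ' f - ψ f - ∑ i, coeff (Finsupp.single i 1) f • (ψ' (X i) - ψ (X i)) ∈ I ^ (n + 1) := by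
  obtain ⟨c, hc, hc'⟩ := exists_eq_C_add_sum_X_mul f
  have : ψ' f - ψ f - ∑ i, coeff (Finsupp.single i 1) f • (ψ' (X i) - ψ (X i)) =
      ∑ i, ((ψ' (X i) - ψ (X i)) * ψ' (c i - C (constantCoeff (c i))) +
          ψ (X i) * (ψ' (c i) - ψ (c i))) := by
    simp only [← hc']
    nth_rw 1 [hc]
    nth_rw 2 [hc]
    simp only [map_add, map_sum, map_mul, algHom_C, map_sub]
    rw [add_sub_add_left_eq_sub, ← Finset.sum_sub_distrib, ← Finset.sum_sub_distrib]
    refine Finset.sum_congr rfl fun i _ => ?_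
    rw [Algebra.smul_def]
    ring
  rw [this]
  refine sum_mem fun i _ => add_mem ?_ ?_
  · rw [pow_succ]
    refine Ideal.mul_mem_mul (hn i) (maximalIdeal_le_comap h' ?_)
    rw [mem_maximalIdeal_iff]; simp
  · rw [pow_succ']
    exact Ideal.mul_mem_mul (h i) (algHom_sub_mem h hn _)

variable {V : Type*} [AddCommGroup V] [Module K V]

theorem MvPowerSeries.rTensor_algHom_sub_mem {n : ℕ} (h : ∀ i, ψ (X i) ∈ I)
    (hn : ∀ i, ψ' (X i) - ψ (X i) ∈ I ^ n) (b : MvPowerSeries (Fin k) K ⊗[K] V) :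
    ψ'.toLinearMap.rTensor V b - ψ.toLinearMap.rTensor V b ∈ adicFil K V I n := by
  induction b with
  | zero => simp
  | add x y hx hy => rw [map_add, map_add, add_sub_add_comm]; exact add_mem hx hy
  | tmul f v =>
    rw [LinearMap.rTensor_tmul, LinearMap.rTensor_tmul, ← TensorProduct.sub_tmul]
    exact tmul_mem_adicFil (algHom_sub_mem h hn f) v

/-- The first order variation of the base change along a homomorphism from a power series
algebra. -/
theorem MvPowerSeries.rTensor_algHom_sub_sub_sum_mem {n : ℕ} (h : ∀ i, ψ (X i) ∈ I)
    (h' : ∀ i, ψ' (X i) ∈ I) (hn : ∀ i, ψ' (X i) - ψ (X i) ∈ I ^ n)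
    (b : MvPowerSeries (Fin k) K ⊗[K] V) :
    ψ'.toLinearMap.rTensor V b - ψ.toLinearMap.rTensor V b -
      ∑ i, (ψ' (X i) - ψ (X i)) ⊗ₜ[K]
        TensorProduct.lid K V ((coeff (R := K) (Finsupp.single i 1)).rTensor V b) ∈
      adicFil K V I (n + 1) := by
  induction b with
  | zero => simp
  | add x y hx hy =>
    have := add_mem hx hy
    rw [sub_add_sub_comm, ← Finset.sum_add_distrib] at this
    simpa only [map_add, TensorProduct.tmul_add, add_sub_add_comm] using this
  | tmul f v =>
    have h1 := tmul_mem_adicFil (V := V) (K := K) (algHom_sub_sub_sum_mem h h' hn f) v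
    simpa only [TensorProduct.sub_tmul, TensorProduct.sum_tmul, TensorProduct.smul_tmul,
      LinearMap.rTensor_tmul, TensorProduct.lid_tmul, AlgHom.toLinearMap_apply] using h1

end PowerSeries
end

noncomputable section

/-! ### Integration, evaluation and constants on `A[t] ⊗ V`. -/

section

variable {K : Type*} [Field K] {A : Type*} [CommRing A] [Algebra K A]
  {V W : Type*} [AddCommGroup V] [Module K V] [AddCommGroup W] [Module K W]

open CompletedTensor Polynomial in
theorem polyEval_one_polyInt_polyC :
    (polyEval K (1 : A)).toLinearMap ∘ₗ polyInt K A ∘ₗ (polyC K A).toLinearMap =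
      LinearMap.id := by
  refine LinearMap.ext fun a => ?_
  change polyEval K (1 : A) (polyInt K A (monomial 0 a)) = a
  rw [polyInt_monomial, map_smul]
  simp [polyEval]

open CompletedTensor in
theorem rTensor_polyDeriv_polyInt [CharZero K] (w : Polynomial A ⊗[K] V) :
    (polyDeriv K A).rTensor V ((polyInt K A).rTensor V w) = w := by
  rw [← LinearMap.rTensor_comp_apply, polyDeriv_comp_polyInt, LinearMap.rTensor_id_apply]

open CompletedTensor in
theorem rTensor_polyEval_zero_polyInt (w : Polynomial A ⊗[K] V) :
    (polyEval K (0 : A)).toLinearMap.rTensor V ((polyInt K A).rTensor V w) = 0 := by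
  rw [← LinearMap.rTensor_comp_apply, polyEval_zero_comp_polyInt, LinearMap.rTensor_zero,
    LinearMap.zero_apply]

open CompletedTensor in
theorem rTensor_polyEval_polyC (c : A) (w : A ⊗[K] V) :
    (polyEval K c).toLinearMap.rTensor V ((polyC K A).toLinearMap.rTensor V w) = w := by
  rw [← LinearMap.rTensor_comp_apply, polyEval_comp_polyC, LinearMap.rTensor_id_apply]

open CompletedTensor in
theorem rTensor_polyDeriv_polyC (w : A ⊗[K] V) :
    (polyDeriv K A).rTensor V ((polyC K A).toLinearMap.rTensor V w) = 0 := by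
  rw [← LinearMap.rTensor_comp_apply, polyDeriv_comp_polyC, LinearMap.rTensor_zero,
    LinearMap.zero_apply]

open CompletedTensor in
theorem rTensor_polyEval_one_polyInt_polyC (w : A ⊗[K] V) :
    (polyEval K (1 : A)).toLinearMap.rTensor V
      ((polyInt K A).rTensor V ((polyC K A).toLinearMap.rTensor V w)) = w := by
  rw [← LinearMap.rTensor_comp_apply, ← LinearMap.rTensor_comp_apply, LinearMap.comp_assoc,
    polyEval_one_polyInt_polyC, LinearMap.rTensor_id_apply]

theorem rTensor_lTensor_comm {A B : Type*} [AddCommGroup A] [Module K A] [AddCommGroup B]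
    [Module K B] (φ : A →ₗ[K] B) (f : V →ₗ[K] W) (x : A ⊗[K] V) :
    φ.rTensor W (f.lTensor A x) = f.lTensor B (φ.rTensor V x) := by
  rw [← LinearMap.comp_apply, ← LinearMap.comp_apply, LinearMap.rTensor_comp_lTensor,
    LinearMap.lTensor_comp_rTensor]

end

/-! ### Improving an approximate flowline by one order. -/

namespace LInfinityAlgebra

variable {K : Type*} [Field K] {V : Type*} [AddCommGroup V] [Module K V]
  (g : LInfinityAlgebra K V)

open CompletedTensor

section

variable {A : Type*} [CommRing A] [Algebra K A] {I : Ideal A}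

/-- An element of degree one which is closed to first order is a combination of elements that span
`H¹` up to an exact element. -/
theorem exists_decomposition {k n : ℕ} {b : Fin k → V}
    (hb : ∀ z ∈ g.cocycles 1, ∃ c : Fin k → K, ∃ δ ∈ g.grading 0, z = ∑ i, c i • b i + g.diff δ)
    {u : A ⊗[K] V} (hu : u ∈ adicFil K V I n) (hu1 : u ∈ (g.grading 1).baseChange A)
    (hdu : g.diff.lTensor A u ∈ adicFil K V I (n + 1)) :
    ∃ c : Fin k → A, (∀ i, c i ∈ I ^ n) ∧ ∃ δ ∈ adicFil K V I n, δ ∈ (g.grading 0).baseChange A ∧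
      u - ∑ i, c i ⊗ₜ[K] b i - g.diff.lTensor A δ ∈ adicFil K V I (n + 1) := by
  let d1 : g.grading 1 →ₗ[K] V := g.diff ∘ₗ (g.grading 1).subtype
  obtain ⟨t, ht⟩ := d1.rangeRestrict.exists_rightInverse_of_surjective d1.range_rangeRestrict
  obtain ⟨p, hp⟩ := LinearMap.exists_leftInverse_of_injective d1.range.subtype
    (Submodule.ker_subtype _)
  -- A linear section of `ℓ¹` on degree one, extended from its range to all of `V`, so that `ℓ¹ s ℓ¹
  -- = ℓ¹` on degree one.
  let s : V →ₗ[K] V := (g.grading 1).subtype ∘ₗ t ∘ₗ p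
  have hs : ∀ v ∈ g.grading 1, g.diff (s (g.diff v)) = g.diff v := by
    intro v hv
    have h1 : p (g.diff v) = d1.rangeRestrict ⟨v, hv⟩ :=
      LinearMap.congr_fun hp (d1.rangeRestrict ⟨v, hv⟩)
    have h2 := LinearMap.congr_fun ht (d1.rangeRestrict ⟨v, hv⟩)
    change d1 (t (p (g.diff v))) = _
    rw [h1]
    exact congrArg Subtype.val h2
  have hs1 : ∀ v, s v ∈ g.grading 1 := fun v => (t (p v)).2
  -- `π` projects degree one onto cocycles, and `u - π u = s (ℓ¹ u)` has order `n + 1`. So `u` can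
  -- be replaced by `π u`, a sum of tensors `a ⊗ z` with `a ∈ I ^ n` and `z` closed, to each of
  -- which `hb` applies.
  let π : V →ₗ[K] V := LinearMap.id - s ∘ₗ g.diff
  have hπ : ∀ v ∈ g.grading 1, π v ∈ g.cocycles 1 := by
    intro v hv
    refine ⟨sub_mem hv (hs1 _), ?_⟩
    change g.diff (v - s (g.diff v)) = 0
    rw [map_sub, hs v hv, sub_self]
  have hdecomp : u - π.lTensor A u ∈ adicFil K V I (n + 1) := by
    have : u - π.lTensor A u = s.lTensor A (g.diff.lTensor A u) := by
      rw [LinearMap.lTensor_sub, LinearMap.sub_apply, LinearMap.lTensor_id, LinearMap.id_apply,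
        sub_sub_cancel, LinearMap.lTensor_comp, LinearMap.comp_apply]
    rw [this]
    exact lTensor_mem_adicFil s hdu
  have key : ∃ c : Fin k → A, (∀ i, c i ∈ I ^ n) ∧ ∃ δ ∈ adicFil K V I n,
      δ ∈ (g.grading 0).baseChange A ∧
      π.lTensor A u = ∑ i, c i ⊗ₜ[K] b i + g.diff.lTensor A δ := by
    refine adicFil_baseChange_induction (lTensor_mem_adicFil π hu) (lTensor_mem_baseChange hπ hu1)
      (fun a ha z hz => ?_) ?_
    · obtain ⟨c, δ, hδ, rfl⟩ := hb z hz
      refine ⟨fun i => c i • a, fun i => Submodule.smul_of_tower_mem _ _ ha, a ⊗ₜ δ,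
        tmul_mem_adicFil ha δ, Submodule.tmul_mem_baseChange_of_mem _ hδ, ?_⟩
      rw [TensorProduct.tmul_add, TensorProduct.tmul_sum, LinearMap.lTensor_tmul]
      simp only [TensorProduct.smul_tmul]
    · rintro x y ⟨c, hc, δ, hδ, hδ0, rfl⟩ ⟨c', hc', δ', hδ', hδ0', rfl⟩
      refine ⟨c + c', fun i => add_mem (hc i) (hc' i), δ + δ', add_mem hδ hδ',
        add_mem hδ0 hδ0', ?_⟩
      simp only [Pi.add_apply, TensorProduct.add_tmul, Finset.sum_add_distrib, map_add]
      abel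
  obtain ⟨c, hc, δ, hδ, hδ0, h⟩ := key
  refine ⟨c, hc, δ, hδ, hδ0, ?_⟩
  rw [sub_sub, ← h]
  exact hdecomp

theorem IsMaurerCartan.mcSum_mem {g : LInfinityAlgebra K V}
    {α : CompletedTensor K I (g.grading 1)} (hα : g.IsMaurerCartan α)
    {n : ℕ} {x : A ⊗[K] V} (hx : reduce n α = adicRed K V I n x) :
    g.mcSum n x ∈ adicFil K V I n := by
  rw [← adicRed_eq_zero_iff, adicRed, rTensor_mcSum, mcSum_eq_sum_Icc]
  have := hα n
  rw [hx] at this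
  exact this

end

section

open MvPowerSeries

variable {k : ℕ}

/-- If the Kodaira--Spencer map is surjective, the first order coefficients of `β` span `H¹`. -/
theorem exists_first_order_coefficients {β : g.MC (MvPowerSeries (Fin k) K)}
    (hβ : Function.Surjective (g.kodairaSpencer β)) :
    ∃ b : Fin k → V,
      (∀ z ∈ g.cocycles 1, ∃ c : Fin k → K, ∃ δ ∈ g.grading 0, z = ∑ i, c i • b i + g.diff δ) ∧
      ∀ n, 2 ≤ n → ∀ x : MvPowerSeries (Fin k) K ⊗[K] V,
        reduce n β.1 = adicRed K V (IsLocalRing.maximalIdeal (MvPowerSeries (Fin k) K)) n x →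
        ∀ i, TensorProduct.lid K V ((coeff (R := K) (Finsupp.single i 1)).rTensor V x) = b i := by
  choose l hl using exists_cotangent_coordinate (K := K) (k := k)
  refine ⟨fun i => (contractCotangent (toCotangent β.1) (l i) : V), fun z hz => ?_,
    fun n hn x hx i => ?_⟩
  · obtain ⟨f, hf⟩ := hβ (Submodule.Quotient.mk ⟨z, hz⟩)
    -- The classes of the variables span the cotangent space and the `l i` are their dual
    -- coordinates, so `f` is determined by its values on the variables.
    have hf' : f = ∑ i, f ((IsLocalRing.maximalIdeal (MvPowerSeries (Fin k) K)).toCotangent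
        ⟨X i, mem_maximalIdeal_iff.2 (constantCoeff_X i)⟩) • l i := by
      refine LinearMap.ext fun y => ?_
      obtain ⟨y, rfl⟩ := Ideal.toCotangent_surjective _ y
      have hy := sub_sum_smul_X_mem y.2
      have h0 : (IsLocalRing.maximalIdeal (MvPowerSeries (Fin k) K)).toCotangent y =
          ∑ i, coeff (Finsupp.single i 1) (y : MvPowerSeries (Fin k) K) •
          (IsLocalRing.maximalIdeal (MvPowerSeries (Fin k) K)).toCotangent
          ⟨X i, mem_maximalIdeal_iff.2 (constantCoeff_X i)⟩ := by
        have h1 : ∀ (c : K) (w : IsLocalRing.maximalIdeal (MvPowerSeries (Fin k) K)),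
            c • (IsLocalRing.maximalIdeal (MvPowerSeries (Fin k) K)).toCotangent w =
            (IsLocalRing.maximalIdeal (MvPowerSeries (Fin k) K)).toCotangent (c • w) :=
          fun c w => rfl
        simp only [h1]
        rw [← map_sum, ← sub_eq_zero, ← map_sub, Ideal.toCotangent_eq_zero]
        simpa using hy
      rw [h0, map_sum, LinearMap.sum_apply]
      refine Finset.sum_congr rfl fun i _ => ?_
      rw [map_smul, LinearMap.smul_apply, map_sum]
      simp only [map_smul, hl, coeff_index_single_X]
      simp [mul_comm]
    have hq := (Submodule.Quotient.eq _).1 hf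
    obtain ⟨δ, hδ, hδ'⟩ := hq
    have hδ'' : g.diff δ = (contractCotangent (toCotangent β.1) f : V) - z := hδ'
    refine ⟨fun i => f ((IsLocalRing.maximalIdeal (MvPowerSeries (Fin k) K)).toCotangent
        ⟨X i, mem_maximalIdeal_iff.2 (constantCoeff_X i)⟩), -δ, neg_mem (by simpa using hδ), ?_⟩
    rw [map_neg, hδ'', hf', map_sum, AddSubmonoidClass.coe_finsetSum]
    simp only [map_smul, Submodule.coe_smul]
    rw [← hf']
    abel
  · exact (contractCotangent_eq hn hx (l i) _ fun a => (hl i a).symm).symm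

variable {R : Type*} [CommRing R] [Algebra K R] {I : Ideal R}

/-- An approximate flowline, modulo `Iⁿ`, from `η` to the base change of `β` along the homomorphism
that maps the `i`-th variable to `x i`. -/
structure ApproxFlowline (g : LInfinityAlgebra K V) {R : Type*} [CommRing R] [Algebra K R]
    {I : Ideal R}
    (β : CompletedTensor K (IsLocalRing.maximalIdeal (MvPowerSeries (Fin k) K)) (g.grading 1))
    (η : CompletedTensor K I (g.grading 1)) (n : ℕ) (x : Fin k → R) (γ a : Polynomial R ⊗[K] V) :
    Prop where
  mem_ideal : ∀ i, x i ∈ I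
  gen_mem : γ ∈ adicFil K V (polyIdeal I) 1
  gen_mem_grading : γ ∈ (g.grading 0).baseChange (Polynomial R)
  path_mem : a ∈ adicFil K V (polyIdeal I) 1
  path_mem_grading : a ∈ (g.grading 1).baseChange (Polynomial R)
  flow : (polyDeriv K R).rTensor V a - g.flowSum n γ a ∈ adicFil K V (polyIdeal I) n
  start : reduce n η = adicRed K V I n ((polyEval K (0 : R)).toLinearMap.rTensor V a)
  -- Stated for every `ψ` with these values on the variables, so that the data contain only the
  -- values; a suitable `ψ` exists when `R` is complete.
  finish : ∀ (ψ : MvPowerSeries (Fin k) K →ₐ[K] R) (h : _ ≤ I.comap ψ), (∀ i, ψ (X i) = x i) →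
    reduce n (CompletedTensor.map ψ h β) =
      adicRed K V I n ((polyEval K (1 : R)).toLinearMap.rTensor V a)

variable {g}

/-- All elements involved have order one, hence vanish modulo `I`, and zero data suffice. -/
theorem ApproxFlowline.one
    (β : CompletedTensor K (IsLocalRing.maximalIdeal (MvPowerSeries (Fin k) K)) (g.grading 1))
    (η : CompletedTensor K I (g.grading 1)) : ApproxFlowline g β η 1 0 0 0 where
  mem_ideal _ := I.zero_mem
  gen_mem := zero_mem _
  gen_mem_grading := zero_mem _
  path_mem := zero_mem _
  path_mem_grading := zero_mem _
  flow := by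
    rw [map_zero, zero_sub]
    exact neg_mem (g.flowSum_mem_adicFil (zero_mem _) (zero_mem _))
  start := by
    obtain ⟨y, hy, -, h⟩ := exists_reduce_eq 1 η
    rw [h, map_zero, map_zero, adicRed_eq_zero_iff]
    exact hy
  finish ψ h _ := by
    obtain ⟨y, hy, -, h⟩ := exists_reduce_eq 1 (CompletedTensor.map ψ h β)
    rw [h, map_zero, map_zero, adicRed_eq_zero_iff]
    exact hy

/-- Approximate flowlines can be improved by one order. -/
theorem ApproxFlowline.exists_succ [CharZero K] [IsAdicComplete I R]
    {β : g.MC (MvPowerSeries (Fin k) K)} (hβ : Function.Surjective (g.kodairaSpencer β))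
    {η : CompletedTensor K I (g.grading 1)} (hη : g.IsMaurerCartan η) {n : ℕ} (hn : 1 ≤ n)
    {x : Fin k → R} {γ a : Polynomial R ⊗[K] V} (H : ApproxFlowline g β.1 η n x γ a) :
    ∃ x' γ' a', ApproxFlowline g β.1 η (n + 1) x' γ' a' ∧ (∀ i, x' i - x i ∈ I ^ n) ∧
      γ' - γ ∈ adicFil K V (polyIdeal I) n ∧ a' - a ∈ adicFil K V (polyIdeal I) n := by
  obtain ⟨b, hb, hb'⟩ := g.exists_first_order_coefficients hβ
  obtain ⟨ηr, hηr, hηr1, hηr'⟩ := exists_reduce_eq (n + 1) η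
  obtain ⟨br, hbr, hbr1, hbr'⟩ := exists_reduce_eq (n + 1) β.1
  have hb'' := hb' (n + 1) (by omega) br hbr'
  obtain ⟨ψ, hψ⟩ := exists_algHom_X (K := K) I x H.mem_ideal
  have hψI : ∀ i, ψ (X i) ∈ I := fun i => by rw [hψ]; exact H.mem_ideal i
  have hψ' := maximalIdeal_le_comap hψI
  -- correct the path so that it solves the flow equation to the next order
  let e0 := (polyEval K (0 : R)).toLinearMap.rTensor V a - ηr
  let e1 := (polyDeriv K R).rTensor V a - g.flowSum (n + 1) γ a
  -- Chosen so that `a₁' = flowSum (n + 1) γ a` and `a₁(0) = ηr` hold exactly. Both corrections have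
  -- order `n`.
  let a₁ := a - (polyInt K R).rTensor V e1 - (polyC K R).toLinearMap.rTensor V e0
  have he0 : e0 ∈ adicFil K V I n := by
    have h1 := H.start
    rw [reduce_eq_of_le n.le_succ hηr', eq_comm, adicRed_eq_iff] at h1
    exact h1
  have he01 : e0 ∈ (g.grading 1).baseChange R :=
    sub_mem (rTensor_mem_baseChange H.path_mem_grading) hηr1
  have he1 : e1 ∈ adicFil K V (polyIdeal I) n := by
    have h1 := sub_mem H.flow (adicFil_anti n.le_succ
      (g.flowSum_sub_mem n.le_succ H.gen_mem H.path_mem))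
    rwa [sub_sub_sub_cancel_right] at h1
  have he11 : e1 ∈ (g.grading 1).baseChange (Polynomial R) :=
    sub_mem (rTensor_mem_baseChange H.path_mem_grading)
      (g.flowSum_mem_one H.gen_mem_grading H.path_mem_grading)
  have hint : ∀ {m : ℕ} {w : Polynomial R ⊗[K] V}, w ∈ adicFil K V (polyIdeal I) m →
      (polyInt K R).rTensor V w ∈ adicFil K V (polyIdeal I) m :=
    fun h => rTensor_mem_adicFil (fun p hp => polyInt_mem hp) h
  have hC : ∀ {m : ℕ} {w : R ⊗[K] V}, w ∈ adicFil K V I m →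
      (polyC K R).toLinearMap.rTensor V w ∈ adicFil K V (polyIdeal I) m :=
    fun h => rTensor_mem_adicFil (fun p hp => polyC_mem (K := K) hp) h
  have hev : ∀ (c : R) {m : ℕ} {w : Polynomial R ⊗[K] V}, w ∈ adicFil K V (polyIdeal I) m →
      (polyEval K c).toLinearMap.rTensor V w ∈ adicFil K V I m :=
    fun c _ _ h => rTensor_mem_adicFil (fun p hp => polyEval_mem (K := K) c hp) h
  have ha₁a : a₁ - a ∈ adicFil K V (polyIdeal I) n := by
    have : a₁ - a = -((polyInt K R).rTensor V e1 + (polyC K R).toLinearMap.rTensor V e0) := by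
      simp only [a₁]; abel
    rw [this]
    exact neg_mem (add_mem (hint he1) (hC he0))
  have ha₁ : a₁ ∈ adicFil K V (polyIdeal I) 1 := by
    have := add_mem (adicFil_anti hn ha₁a) H.path_mem
    rwa [sub_add_cancel] at this
  have ha₁1 : a₁ ∈ (g.grading 1).baseChange (Polynomial R) :=
    sub_mem (sub_mem H.path_mem_grading (rTensor_mem_baseChange he11)) (rTensor_mem_baseChange he01)
  have hDa₁ : (polyDeriv K R).rTensor V a₁ = g.flowSum (n + 1) γ a := by
    simp only [a₁, map_sub, rTensor_polyDeriv_polyInt, rTensor_polyDeriv_polyC, sub_zero, e1,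
      sub_sub_cancel]
  have hev0 : (polyEval K (0 : R)).toLinearMap.rTensor V a₁ = ηr := by
    simp only [a₁, map_sub, rTensor_polyEval_zero_polyInt, rTensor_polyEval_polyC, sub_zero, e0,
      sub_sub_cancel]
  -- Replacing `a` by `a₁` in the vector field costs only order `n + 1`, since `a` always occurs
  -- there together with `γ`, which has order one.
  have hflow₁ : (polyDeriv K R).rTensor V a₁ - g.flowSum (n + 1) γ a₁ ∈
      adicFil K V (polyIdeal I) (n + 1) := by
    have h1 := g.flowSum_sub_sub_diff_mem (M := n + 1) (by omega) hn H.gen_mem H.path_mem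
      (γ' := γ) (by rw [sub_self]; exact zero_mem _) ha₁a
    rw [sub_self, map_zero, sub_zero] at h1
    rw [hDa₁, ← neg_sub]
    exact neg_mem h1
  -- compare the end point with the base change of `β`
  have hmc : g.mcSum (n + 1) ((polyEval K (1 : R)).toLinearMap.rTensor V a₁) ∈
      adicFil K V I (n + 1) := by
    rw [← rTensor_mcSum]
    refine hev 1 (g.mcSum_mem_of_flow H.gen_mem H.gen_mem_grading ha₁ ha₁1 hflow₁ ?_)
    rw [hev0]
    exact hη.mcSum_mem hηr'
  have hψpow : ∀ m, ∀ s ∈ IsLocalRing.maximalIdeal (MvPowerSeries (Fin k) K) ^ m,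
      ψ.toLinearMap s ∈ I ^ m := fun m s hs =>
    ((Ideal.pow_right_mono hψ' m).trans (Ideal.le_comap_pow ψ m)) hs
  have hz : ψ.toLinearMap.rTensor V br ∈ adicFil K V I 1 := rTensor_mem_adicFil (hψpow 1) hbr
  have hz1 : ψ.toLinearMap.rTensor V br ∈ (g.grading 1).baseChange R := rTensor_mem_baseChange hbr1
  have hmcz : g.mcSum (n + 1) (ψ.toLinearMap.rTensor V br) ∈ adicFil K V I (n + 1) := by
    rw [← rTensor_mcSum]
    exact rTensor_mem_adicFil (hψpow _) (IsMaurerCartan.mcSum_mem β.2 hbr')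
  let u := (polyEval K (1 : R)).toLinearMap.rTensor V a₁ - ψ.toLinearMap.rTensor V br
  have hu : u ∈ adicFil K V I n := by
    have h1 := H.finish ψ hψ' hψ
    rw [reduce_eq_of_le n.le_succ (reduce_map ψ hψ' hbr'), eq_comm, adicRed_eq_iff] at h1
    have h2 := add_mem (hev 1 ha₁a) h1
    rwa [map_sub, sub_add_sub_cancel] at h2
  have hu1 : u ∈ (g.grading 1).baseChange R := sub_mem (rTensor_mem_baseChange ha₁1) hz1
  -- The endpoint and the base change of `β` both have curvature of order `n + 1`, and the
  -- difference of the curvatures is `ℓ¹ u` up to that order.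
  have hdu : g.diff.lTensor R u ∈ adicFil K V I (n + 1) := by
    have h1 := g.mcSum_sub_sub_diff_mem (M := n + 1) (by omega) hn hz hu
    have h2 := sub_mem (sub_mem hmc hmcz) h1
    rwa [sub_sub_cancel] at h2
  obtain ⟨c, hc, δ, hδ, hδ0, hdec⟩ := g.exists_decomposition hb hu hu1 hdu
  -- correct the homomorphism and the gauge transformation
  have hcI : ∀ i, c i ∈ I := fun i => by
    have := Ideal.pow_le_pow_right hn (hc i)
    rwa [pow_one] at this
  have hxI : ∀ i, x i + c i ∈ I := fun i => I.add_mem (H.mem_ideal i) (hcI i)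
  have hdδ : g.diff.lTensor R δ ∈ adicFil K V I n := lTensor_mem_adicFil _ hδ
  have hdiff : ∀ v ∈ g.grading 0, g.diff v ∈ g.grading 1 := fun v hv => by
    have := g.bracket_mem 1 (fun _ => 0) (fun _ => v) fun _ => hv
    simpa [diff_apply] using this
  -- `a₂ = a₁ - t ℓ¹ δ` keeps the initial value and moves the endpoint by `-ℓ¹ δ`; to first order,
  -- `γ - δ` generates this change.
  let a₂ := a₁ - (polyInt K R).rTensor V ((polyC K R).toLinearMap.rTensor V (g.diff.lTensor R δ))
  let γ₂ := γ - (polyC K R).toLinearMap.rTensor V δ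
  have hγ₂ : γ₂ - γ ∈ adicFil K V (polyIdeal I) n := by
    rw [sub_sub_cancel_left]
    exact neg_mem (hC hδ)
  have ha₂ : a₂ - a₁ ∈ adicFil K V (polyIdeal I) n := by
    rw [sub_sub_cancel_left]
    exact neg_mem (hint (hC hdδ))
  have ha₂a : a₂ - a ∈ adicFil K V (polyIdeal I) n := by
    have := add_mem ha₂ ha₁a
    rwa [sub_add_sub_cancel] at this
  refine ⟨fun i => x i + c i, γ₂, a₂, ⟨hxI, ?_, ?_, ?_, ?_, ?_, ?_, ?_⟩, fun i => ?_, hγ₂, ha₂a⟩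
  · exact sub_mem H.gen_mem (adicFil_anti hn (hC hδ))
  · exact sub_mem H.gen_mem_grading (rTensor_mem_baseChange hδ0)
  · exact sub_mem ha₁ (adicFil_anti hn (hint (hC hdδ)))
  · exact sub_mem ha₁1 (rTensor_mem_baseChange (rTensor_mem_baseChange
      (lTensor_mem_baseChange hdiff hδ0)))
  · have h1 := g.flowSum_sub_sub_diff_mem (M := n + 1) (by omega) hn H.gen_mem ha₁ hγ₂ ha₂
    have h2 := sub_mem hflow₁ h1
    have h3 : (polyDeriv K R).rTensor V a₂ = (polyDeriv K R).rTensor V a₁ +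
        g.diff.lTensor (Polynomial R) (γ₂ - γ) := by
      simp only [a₂, γ₂, map_sub, rTensor_polyDeriv_polyInt, rTensor_lTensor_comm]
      abel
    rw [h3]
    convert h2 using 1
    abel
  · rw [hηr']
    simp only [a₂, map_sub, rTensor_polyEval_zero_polyInt, hev0, sub_zero]
  · intro ψ₂ h₂ hψ₂
    rw [reduce_map ψ₂ h₂ hbr', eq_comm, adicRed_eq_iff]
    have hψ₂I : ∀ i, ψ₂ (X i) ∈ I := fun i => by rw [hψ₂]; exact hxI i
    have hsub : ∀ i, ψ₂ (X i) - ψ (X i) = c i := fun i => by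
      rw [hψ₂, hψ, add_sub_cancel_left]
    -- The base change of `β` moves by the sum of `c i ⊗ b i` up to order `n + 1`, which together
    -- with `-ℓ¹ δ` at the endpoint cancels `u`.
    have h1 := rTensor_algHom_sub_sub_sum_mem hψI hψ₂I (fun i => by rw [hsub]; exact hc i) br
    simp only [hsub, hb''] at h1
    have h3 := sub_mem hdec h1
    convert h3 using 1
    simp only [a₂, map_sub, rTensor_polyEval_one_polyInt_polyC, u]
    abel
  · simpa using hc i

end

end LInfinityAlgebra
end

noncomputable section

/-! ### Gauge invariance of the first order class. -/

namespace LInfinityAlgebra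

variable {K : Type*} [Field K] {V : Type*} [AddCommGroup V] [Module K V]
  {g : LInfinityAlgebra K V}

open CompletedTensor

section

variable {A : Type*} [CommRing A] [Algebra K A] {I : Ideal A}

theorem adicRed_flowSum (n : ℕ) (γ x : A ⊗[K] V) :
    adicRed K V I n (g.flowSum n γ x) = ∑ i ∈ Finset.range n, ((i.factorial : K)⁻¹) •
      g.bracketOver (A ⧸ I ^ n) (i + 1)
        (Fin.cons (adicRed K V I n γ) fun _ => adicRed K V I n x) := by
  rw [adicRed, rTensor_flowSum]
  rfl

theorem lid_rTensor_mem {P : Submodule K V} (μ : A →ₗ[K] K) {x : A ⊗[K] V}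
    (hx : x ∈ P.baseChange A) : TensorProduct.lid K V (μ.rTensor V x) ∈ P := by
  refine baseChange_induction hx (fun a v hv => ?_) (fun x y hx hy => ?_)
  · rw [LinearMap.rTensor_tmul, TensorProduct.lid_tmul]
    exact P.smul_mem _ hv
  · rw [map_add, map_add]
    exact add_mem hx hy

theorem lid_lTensor {W : Type*} [AddCommGroup W] [Module K W] (f : V →ₗ[K] W) (x : K ⊗[K] V) :
    TensorProduct.lid K W (f.lTensor K x) = f (TensorProduct.lid K V x) := by
  induction x with
  | zero => simp
  | add x y hx hy => simp only [map_add, hx, hy]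
  | tmul c v => simp

/-- The class in `H¹` of a first order deformation does not change along flowlines. -/
theorem IsFlowline.contract_sub_mem [CharZero K] {α₀ α₁ : CompletedTensor K I (g.grading 1)}
    (h : g.IsFlowline α₀ α₁) (l : Module.Dual K I.Cotangent) :
    (contractCotangent (toCotangent α₀) l : V) - (contractCotangent (toCotangent α₁) l : V) ∈
      g.coboundaries 1 := by
  obtain ⟨γ, a, hflow, rfl, rfl⟩ := h
  obtain ⟨γr, hγ, hγ0, hγr⟩ := exists_reduce_eq 2 γ
  obtain ⟨ar, ha, ha1, har⟩ := exists_reduce_eq 2 a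
  obtain ⟨μ, hμ⟩ := exists_extension_dual_cotangent I l
  rw [contractCotangent_eq le_rfl (reduce_evalAt 0 har) l μ hμ,
    contractCotangent_eq le_rfl (reduce_evalAt 1 har) l μ hμ]
  have h1 := hflow 2
  rw [reduce_deriv har, hγr, har, ← adicRed_flowSum, adicRed_eq_iff] at h1
  -- Comparing the generator with zero shows that modulo the square of the ideal the vector field is
  -- `ℓ¹ γ`, independent of the path.
  have h2 := g.flowSum_sub_sub_diff_mem (M := 2) (n := 1) (by omega) le_rfl
    (I := polyIdeal I) (γ := 0) (γ' := γr) (zero_mem _) ha (by simpa using hγ) (x' := ar)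
    (by rw [sub_self]; exact zero_mem _)
  rw [sub_zero] at h2
  have h3 := add_mem (add_mem h1 h2) (g.flowSum_mem_adicFil (M := 2) (γ := (0 : Polynomial A ⊗[K] V))
    (I := polyIdeal I) (n := 2) (zero_mem _) ha)
  have h4 : (polyDeriv K A).rTensor V ar - g.diff.lTensor (Polynomial A) γr ∈
      adicFil K V (polyIdeal I) 2 := by
    convert h3 using 1
    abel
  have h5 := rTensor_mem_adicFil (φ := (polyEval K (1 : A)).toLinearMap)
    (fun p hp => polyEval_mem (K := K) (1 : A) hp)
    (rTensor_mem_adicFil (φ := polyInt K A) (fun p hp => polyInt_mem hp) h4)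
  -- Integrating `a' = ℓ¹ γ` from `0` to `1` gives `a(1) - a(0) = ℓ¹ ∫ γ`; the sign of the primitive
  -- below comes from the order `α₀ - α₁`.
  have h6 := LinearMap.congr_fun (congrArg (LinearMap.rTensor V)
    (polyInt_comp_polyDeriv (K := K) (A := A))) ar
  rw [LinearMap.rTensor_add, LinearMap.rTensor_comp, LinearMap.rTensor_comp,
    LinearMap.rTensor_id, LinearMap.id_apply, LinearMap.add_apply, LinearMap.comp_apply,
    LinearMap.comp_apply, ← eq_sub_iff_add_eq] at h6
  rw [map_sub, h6] at h5
  have h7 : μ.rTensor V _ = 0 := rTensor_eq_zero_of_mem_adicFil (fun b hb => by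
    have hb' : b ∈ I := Ideal.pow_le_self two_ne_zero hb
    rw [hμ ⟨b, hb'⟩, (Ideal.toCotangent_eq_zero _ _).2 hb, map_zero]) h5
  rw [rTensor_lTensor_comm, map_sub, map_sub, map_sub, map_sub] at h7
  have h8 := congrArg (TensorProduct.lid K V) h7
  simp only [map_sub, map_zero, rTensor_polyEval_polyC,
    rTensor_lTensor_comm, lid_lTensor] at h8
  refine ⟨-TensorProduct.lid K V (μ.rTensor V ((polyEval K (1 : A)).toLinearMap.rTensor V
    ((polyInt K A).rTensor V γr))), neg_mem ?_, ?_⟩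
  · simpa using lid_rTensor_mem μ (rTensor_mem_baseChange (rTensor_mem_baseChange hγ0))
  · rw [map_neg, ← sub_eq_zero.1 h8, neg_sub]

theorem GaugeEquiv.contract_sub_mem [CharZero K] {α₀ α₁ : CompletedTensor K I (g.grading 1)}
    (h : g.GaugeEquiv α₀ α₁) (l : Module.Dual K I.Cotangent) :
    (contractCotangent (toCotangent α₀) l : V) - (contractCotangent (toCotangent α₁) l : V) ∈
      g.coboundaries 1 := by
  induction h with
  | rel x y h => exact h.contract_sub_mem l
  | refl x => rw [sub_self]; exact zero_mem _
  | symm x y _ ih => rw [← neg_sub]; exact neg_mem ih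
  | trans x y z _ _ ih ih' => rw [← sub_add_sub_cancel]; exact add_mem ih ih'

/-- Naturality: if `μ` extends `l` to `B`, then `μ ∘ ψ` extends the pulled back form to `A`. It
expresses the class of `ψ^* β` through the Kodaira-Spencer map of `β`. -/
theorem contractCotangent_map {B : Type*} [CommRing B] [Algebra K B] {J : Ideal B}
    {P : Submodule K V} (ψ : A →ₐ[K] B) (h : I ≤ J.comap ψ) (α : CompletedTensor K I P)
    (l : Module.Dual K J.Cotangent) :
    (contractCotangent (toCotangent (CompletedTensor.map ψ h α)) l : V) =
      contractCotangent (toCotangent α) (l ∘ₗ Ideal.mapCotangent I J ψ h) := by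
  obtain ⟨x, -, -, hx⟩ := exists_reduce_eq 2 α
  obtain ⟨μ, hμ⟩ := exists_extension_dual_cotangent J l
  rw [contractCotangent_eq le_rfl (reduce_map ψ h hx) l μ hμ,
    contractCotangent_eq le_rfl hx (l ∘ₗ Ideal.mapCotangent I J ψ h) (μ ∘ₗ ψ.toLinearMap) fun a => hμ ⟨ψ a, h a.2⟩,
    LinearMap.rTensor_comp_apply]

end

/-! ### Passing to the limit, and the theorem. -/

section

open MvPowerSeries

variable {k : ℕ} {R : Type*} [CommRing R] [Algebra K R] {I : Ideal R}

/-- If the Kodaira--Spencer map is surjective, every Maurer--Cartan element is joined to a base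
change by a flowline. -/
theorem exists_isFlowline_map [CharZero K] [IsAdicComplete I R]
    {β : g.MC (MvPowerSeries (Fin k) K)} (hβ : Function.Surjective (g.kodairaSpencer β))
    {η : CompletedTensor K I (g.grading 1)} (hη : g.IsMaurerCartan η) :
    ∃ (ψ : MvPowerSeries (Fin k) K →ₐ[K] R)
      (h : IsLocalRing.maximalIdeal (MvPowerSeries (Fin k) K) ≤ I.comap ψ),
      g.IsFlowline η (CompletedTensor.map ψ h β.1) := by
  -- Stage `n` is an approximation modulo `I ^ (n + 1)`, since the construction starts at order one.
  -- Successive stages are packed in a subtype to allow recursive choice.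
  have hstep : ∀ n, ∀ p : {p : (Fin k → R) × (Polynomial R ⊗[K] V) × (Polynomial R ⊗[K] V) //
      ApproxFlowline g β.1 η (n + 1) p.1 p.2.1 p.2.2},
      ∃ q : {p : (Fin k → R) × (Polynomial R ⊗[K] V) × (Polynomial R ⊗[K] V) //
      ApproxFlowline g β.1 η (n + 2) p.1 p.2.1 p.2.2},
      (∀ i, q.1.1 i - p.1.1 i ∈ I ^ (n + 1)) ∧
      q.1.2.1 - p.1.2.1 ∈ adicFil K V (polyIdeal I) (n + 1) ∧
      q.1.2.2 - p.1.2.2 ∈ adicFil K V (polyIdeal I) (n + 1) := by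
    rintro n ⟨p, hp⟩
    obtain ⟨x, γ, a, h, h1, h2, h3⟩ := hp.exists_succ hβ hη (by omega)
    exact ⟨⟨(x, γ, a), h⟩, h1, h2, h3⟩
  choose next hnext using hstep
  let p : ∀ n, {p : (Fin k → R) × (Polynomial R ⊗[K] V) × (Polynomial R ⊗[K] V) //
      ApproxFlowline g β.1 η (n + 1) p.1 p.2.1 p.2.2} := fun n =>
    Nat.rec ⟨(0, 0, 0), ApproxFlowline.one β.1 η⟩ next n
  have hp : ∀ n, (∀ i, (p (n + 1)).1.1 i - (p n).1.1 i ∈ I ^ (n + 1)) ∧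
      (p (n + 1)).1.2.1 - (p n).1.2.1 ∈ adicFil K V (polyIdeal I) (n + 1) ∧
      (p (n + 1)).1.2.2 - (p n).1.2.2 ∈ adicFil K V (polyIdeal I) (n + 1) := fun n =>
    hnext n (p n)
  obtain ⟨γ, hγ⟩ := exists_of_coherent (I := polyIdeal I) (P := g.grading 0)
    (fun n => (p n).1.2.1) (fun n => (p n).2.gen_mem) (fun n => (p n).2.gen_mem_grading)
    (fun n => adicFil_anti n.le_succ (hp n).2.1)
  obtain ⟨a, ha⟩ := exists_of_coherent (I := polyIdeal I) (P := g.grading 1)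
    (fun n => (p n).1.2.2) (fun n => (p n).2.path_mem) (fun n => (p n).2.path_mem_grading)
    (fun n => adicFil_anti n.le_succ (hp n).2.2)
  have hx : ∀ i, ∃ y, ∀ n, (p n).1.1 i - y ∈ I ^ n := fun i => by
    have hc : ∀ {m n}, m ≤ n → (p m).1.1 i ≡ (p n).1.1 i [SMOD (I ^ m • ⊤ : Submodule R R)] := by
      intro m n hmn
      induction n, hmn using Nat.le_induction with
      | base => rfl
      | succ n hmn ih =>
        refine ih.trans ?_
        rw [SModEq.comm, SModEq.sub_mem, smul_eq_mul, Ideal.mul_top]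
        exact Ideal.pow_le_pow_right (by omega) ((hp n).1 i)
    obtain ⟨y, hy⟩ := IsPrecomplete.prec (inferInstance : IsPrecomplete I R) hc
    refine ⟨y, fun n => ?_⟩
    have := hy n
    rwa [SModEq.sub_mem, smul_eq_mul, Ideal.mul_top] at this
  choose x hx using hx
  have hxI : ∀ i, x i ∈ I := fun i => by
    have h1 := I.sub_mem ((p 1).2.mem_ideal i) (by simpa using hx i 1)
    rwa [sub_sub_cancel] at h1
  obtain ⟨ψ, hψ⟩ := exists_algHom_X (K := K) I x hxI
  have hψI : ∀ i, ψ (X i) ∈ I := fun i => by rw [hψ]; exact hxI i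
  refine ⟨ψ, maximalIdeal_le_comap hψI, γ, a, fun n => ?_, ext_reduce fun n => ?_,
    ext_reduce fun n => ?_⟩
  · rw [reduce_deriv (ha n), hγ n, ha n, ← adicRed_flowSum, adicRed_eq_iff]
    -- Stage `n` uses `n + 1` terms of the vector field where the flow equation modulo `I ^ n` has
    -- `n`; the last term has order `n + 1`.
    have h1 := add_mem (p n).2.flow
      (g.flowSum_sub_mem n.le_succ (p n).2.gen_mem (p n).2.path_mem)
    rw [sub_add_sub_cancel] at h1
    exact adicFil_anti n.le_succ h1
  · rw [reduce_evalAt 0 (ha n), reduce_eq_of_le n.le_succ (p n).2.start]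
  · obtain ⟨ψ', hψ'⟩ := exists_algHom_X (K := K) I _ (p n).2.mem_ideal
    have hψI' : ∀ i, ψ' (X i) ∈ I := fun i => by rw [hψ']; exact (p n).2.mem_ideal i
    obtain ⟨b, -, -, hb⟩ := exists_reduce_eq n β.1
    have h1 := reduce_eq_of_le n.le_succ
      ((p n).2.finish ψ' (maximalIdeal_le_comap hψI') hψ')
    rw [reduce_evalAt 1 (ha n), ← h1, reduce_map _ _ hb, reduce_map _ _ hb, adicRed_eq_iff]
    exact rTensor_algHom_sub_mem hψI (fun i => by rw [hψ, hψ']; exact hx i n) b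

end

end LInfinityAlgebra
end

theorem theorem2 {K : Type*} [Field K] [CharZero K] {V : Type*} [AddCommGroup V] [Module K V]
    (g : LInfinityAlgebra K V) (k : ℕ) (β : g.MC (MvPowerSeries (Fin k) K)) :
    (Function.Bijective (g.kodairaSpencer β) → LInfinityAlgebra.IsVersalMC.{w} g β) ∧
      (Function.Surjective (g.kodairaSpencer β) → LInfinityAlgebra.IsCompleteMC.{w} g β) := by
  have hcomplete : Function.Surjective (g.kodairaSpencer β) →
      LInfinityAlgebra.IsCompleteMC.{w} g β := by
    intro hβ R _ _ _ _ _ η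
    obtain ⟨ψ, h, hflow⟩ := LInfinityAlgebra.exists_isFlowline_map hβ η.2
    exact ⟨ψ, h, Relation.EqvGen.rel _ _ hflow⟩
  refine ⟨fun hβ => ⟨hcomplete hβ.2, ?_⟩, hcomplete⟩
  intro R _ _ _ _ _ η ψ ψ' h h' hg hg'
  refine LinearMap.ext fun y => ?_
  -- Linear forms over `K` separate the points of the cotangent space of `R`, so it is enough to
  -- compare the two cotangent maps after composing with each `l`.
  rw [← sub_eq_zero, ← Module.forall_dual_apply_eq_zero_iff K]
  intro l
  have hl : l ∘ₗ Ideal.mapCotangent _ _ ψ h = l ∘ₗ Ideal.mapCotangent _ _ ψ' h' := by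
    -- Both base changes are gauge equivalent to the same element, so their contractions with `l`
    -- differ by a coboundary. Those are the values of `KS_β` on the two forms, which agree by
    -- injectivity.
    refine hβ.1 ((Submodule.Quotient.eq _).2 ?_)
    have h1 := LInfinityAlgebra.GaugeEquiv.contract_sub_mem
      (Relation.EqvGen.trans _ _ _ (Relation.EqvGen.symm _ _ hg) hg') l
    rw [LInfinityAlgebra.contractCotangent_map, LInfinityAlgebra.contractCotangent_map] at h1
    exact h1
  rw [map_sub, sub_eq_zero]
  exact LinearMap.congr_fun hl y
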